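/- \textbf{Setting.} Let $s,q,K,H\in\mathbb N_0$ and let $A_{kh}\in\mathbb R^{s\times s}$ ($0\le k\le K$, $0\le h\le H$) satisfy $A_{Kh}\ne0$ for some $h$ and $A_{kH}\neq 0$ for some $k$. Put $A_i^*=\sum_{h-k=i}A_{kh}$, let $J_0$ and $J_1$ be the least and the greatest $i\in\mathbb Z$ with $A_i^*\ne 0$, let $\pi(z)=\sum_{i=J_0}^{J_1}A_i^*z^{J_1-i}$, and assume $\det\pi\not\equiv0$. Let $\pi=P\alpha\Phi Q$ be a Smith form: $P,Q$ unimodular, $\alpha=\mathrm{diag}(z^{g_1},\dots,z^{g_s})$ with $0\le g_1\le\dots\le g_s$, and $\Phi=\mathrm{diag}(\phi_1,\dots,\phi_s)$ with $\phi_k\mid\phi_{k+1}$, $\phi_k(0)\neq0$. Let $(u_t)_{t\in\mathbb Z}$ be an $s$-dimensional linearly regular stationary process with Wold representation $u_t=\sum_{i\ge0}w_i\varepsilon_{t-i}$, $w_i\in\mathbb R^{s\times q}$, where $\varepsilon$ is a $q$-dimensional white noise with covariance matrix of rank $q$ and $\varepsilon_t\in H_u(t)$, the closed linear span in $L^2$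 of the components of $u_t,u_{t-1},\dots$. Let $\mathbb E_t$ be the orthogonal projection onto $H_u(t)$. A process is called causal stationary if it is of the form $x_t=\sum_{n\ge0}k_n\varepsilon_{t-n}$ with $k_n\in\mathbb R^{s\times q}$. The symbol $z$ also denotes the backward shift. Let $\gamma=(s_0,\dots,s_H)$, $\sum_i s_i=s$, $n_j=s_0+\dots+s_j$; the components of $y_t$ are partitioned accordingly into $y^{s_0}_t,\dots,y^{s_H}_t$. We write $y_t\in H^{Pre}(t;\gamma)$ if $y_t\in H_u(t)$ and $(\mathbb E_t-\mathbb E_{t-1})y^{s_i}_{t+j}=0$ for all $t$ and $0\le j<\min(i,H)$. We consider martingale difference sequences (MDS) $\varepsilon^j_t$, $0\le j<H$, i.e. $\mathbb E_t\varepsilon_t^j=\varepsilon_t^j$, $\mathbb E_{t-1}\varepsilon_t^j=0$, with $\varepsilon_t^{j,s_i}=0$ for $i>j$, and put $\zeta_t=-\sum_{k=0}^K\sum_{j=0}^{H-1}\sum_{h=0}^jA_{kh}\,\varepsilon^j_{t-(k+j-h)}=\sum_i m_{i,\bullet}\,\varepsilon^\bullet_{t-i}$, where $\varepsilon^\bullet_t$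 stacks $\varepsilon_t^0,\dots,\varepsilon_t^{H-1}$. The $\bigl(\sum_{i<H}s_i(H-i)\bigr)\times sH$ matrix $R$ selects the first $n_j$ components of the block $j$, $0\le j<H$; $\varepsilon^{p}_t=R\varepsilon_t^\bullet$. Let $S$ be the block diagonal matrix with blocks $\omega_{0,n_i}^\dagger$, $0\le i<H$, the Moore--Penrose pseudo-inverses of the first $n_i$ columns of $\omega_0=\Phi(0)Q(0)$. The constraints are $$S\,(\mathbb E_{t-i}-\mathbb E_{t-(i+1)})\bigl[\alpha(z)^{-1}P(z)^{-1}(\zeta_{t-J_1}-u_{t-J_1})\bigr]=0,\qquad i=0,\dots,H-1,\ t\in\mathbb Z,\tag{C}$$ with $S$ acting on the vector stacked over $i$. The structural difference equation (SDE) is $$\pi(z)y_t=\pi(z)(\varepsilon_t^0+\dots+\varepsilon^{H-1}_{t-H+1})+\zeta_{t-J_1}-u_{t-J_1}.$$ Its \emph{free parameters} are the real matrices $X$ with $q$ columns such that the MDS given by $\varepsilon^p_t=X\varepsilon_t$ (the remaining components being zero) satisfy (C). Let $\mathcal F$ be the set of free parameters; ``there are $N$ free parameters'' means that $\mathcal F$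 is a non-empty affine space of dimension $N$. A causal stationary process $y$ with $y_t\in H^{Pre}(t;\gamma)$ solves the rational expectations model $\sum_{k=0}^{K}\sum_{h=0}^{H}A_{kh}\mathbb E_{t-k}(y_{t+h-k})=-u_t$ if and only if it solves the SDE for some $X\in\mathcal F$. Let $\mathfrak P_{k,\bullet|n}$ and $\mathfrak P_{\bullet,\bullet|n}$ be the $k$-th row of, and the whole, coefficient of $z^n$ in $P(z)^{-1}$; let $\mathfrak P_{k,\bullet|n}=0$ for $n<0$. For $L\ge H$ let $\mathfrak P^{k,\bullet}$ be the $H\times sL$ matrix whose rows $i=0,\dots,H-1$ and $1\times s$ block columns $l=0,\dots,L-1$ are as follows: if $g_k\le J_1$ and $\delta_k=J_1-g_k$, the first $\delta_k$ rows are zero and the $(i,l)$ block for $i\ge\delta_k$ is $\mathfrak P_{k,\bullet|i-\delta_k-l}$; if $g_k>J_1$ and $\gamma_k=g_k-J_1$, the $(i,l)$ block is $\mathfrak P_{k,\bullet|\gamma_k+i-l}$. Let $\mathfrak P^{(L)}$ be the stack of $\mathfrak P^{1,\bullet},\dots,\mathfrak P^{s,\bullet}$, let $m^{(L)}$ be the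 stack of $m_{0,\bullet},\dots,m_{L-1,\bullet}$, let $T^{(L)}$ be the block lower triangular Toeplitz matrix with $(i,l)$ block $\mathfrak P_{\bullet,\bullet|i-l}$, $0\le l\le i<L$, let $u^{(L)}_t$ be the stack of $u_t,\dots,u_{t+L-1}$, and let $U$ be the permutation matrix whose row $(k,i)$ selects the $k$-th row of the $i$-th of $H$ blocks of $s$ rows. \textbf{Theorem.} \begin{enumerate} \item Let $L=H+\max(g_s-J_1,0)$. For MDS as above, (C) is equivalent to $$SU^T\mathfrak P^{(L)}m^{(L)}R^T\varepsilon^p_t=SU^T\mathfrak P^{(L)}(\mathbb E_t-\mathbb E_{t-1})u^{(L)}_t\qquad\text{for all }t.$$ If $\mathcal F\ne\emptyset$, the number of free parameters is $q$ times the dimension of the right kernel of $SU^T\mathfrak P^{(L)}m^{(L)}R^T$. \item If $g_i\le J_1$ for all $i$, then the assertions of 1 hold with $L=H$. \item If $g_i=\bar g\le J_1$ for all $i$, put $d=J_1-\bar g$ and let $S_{2,\bar g}$ be the bottom right submatrix of $S$ obtained by deleting its first $d$ diagonal blocks; it has $(H-d)\sum_{i<d}s_i+\sum_{i=d}^{H-1}s_i(H-i)$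 rows and $s(H-d)$ columns. Then (C) is equivalent to $$S_{2,\bar g}T^{(H-d)}m^{(H-d)}R^T\varepsilon_t^p=S_{2,\bar g}T^{(H-d)}(\mathbb E_t-\mathbb E_{t-1})u_t^{(H-d)}\qquad\text{for all }t.$$ If $m^{(H-d)}R^T$ has full row rank, there are $\bigl[\sum_{i=0}^{J_1-1}s_i(J_1-\bar g-i)\bigr]q$ free parameters. \item If $g_i=0\le J_1$ for all $i$, the equivalence of 3 holds with $d=J_1$, and if $m^{(H-J_1)}R^T$ has full row rank, there are $\bigl[\sum_{i=0}^{J_1-1}s_i(J_1-i)\bigr]q$ free parameters. \item Assume in addition that all non-zero zeros of $\det\pi(z)$ lie outside the closed unit disc. Then causal stationary solutions of the SDE belonging to two distinct free parameters are distinct. A free parameter generates exactly one causal stationary solution of the SDE if and only if $\alpha(z)^{-1}P(z)^{-1}(\zeta_{t-J_1}-u_{t-J_1})\in H_u(t)$ for all $t$; in particular every free parameter does if $g_i\le J_1$ for all $i$. \end{enumerate} -/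

import Mathlib

open scoped BigOperators
open MeasureTheory

noncomputable section

namespace REM

/-! ### Real matrices and polynomial matrices in the lag operator, acting on `L²` processes -/

section Operators

variable {E : Type*} [AddCommGroup E] [Module ℝ E]

/-- A real matrix acting on a vector whose entries are random variables. -/
def act {m n : Type*} [Fintype n] (M : Matrix m n ℝ) (x : n → E) : m → E :=
  fun r => ∑ c, M r c • x c

/-- A polynomial matrix `M(z)` acting on a process, `z` being the backward shift:
`(M(z) x)_t = ∑ₙ Mₙ x_{t-n}`. -/
def lagAct {m n : Type*} [Fintype n] (M : Matrix m n (Polynomial ℝ)) (x : ℤ → n → E) :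
    ℤ → m → E :=
  fun t r => ∑ c, (M r c).sum fun p a => a • x (t - p) c

end Operators

/-! ### The matrix polynomial of the model and its Smith form -/

section Algebra

variable {s K H : ℕ}

/-- `A*ᵢ`, the sum of the `A_{kh}` with `h - k = i`. -/
def Astar (A : Fin (K + 1) → Fin (H + 1) → Matrix (Fin s) (Fin s) ℝ) (i : ℤ) :
    Matrix (Fin s) (Fin s) ℝ :=
  ∑ k : Fin (K + 1), ∑ h : Fin (H + 1), if ((h : ℕ) : ℤ) - ((k : ℕ) : ℤ) = i then A k h else 0

/-- `J₀`, the least `i` with `A*ᵢ ≠ 0`. -/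
def J0 (A : Fin (K + 1) → Fin (H + 1) → Matrix (Fin s) (Fin s) ℝ) : ℤ := sInf {i | Astar A i ≠ 0}

/-- `J₁`, the greatest `i` with `A*ᵢ ≠ 0`. -/
def J1 (A : Fin (K + 1) → Fin (H + 1) → Matrix (Fin s) (Fin s) ℝ) : ℤ := sSup {i | Astar A i ≠ 0}

/-- `π(z) = z^{J₁} ∑_{i=J₀}^{J₁} A*ᵢ z^{-i}`. -/
def piPoly (A : Fin (K + 1) → Fin (H + 1) → Matrix (Fin s) (Fin s) ℝ) :
    Matrix (Fin s) (Fin s) (Polynomial ℝ) :=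
  fun r c => ∑ i ∈ Finset.Icc (J0 A) (J1 A), Polynomial.monomial (J1 A - i).toNat (Astar A i r c)

/-- A Smith form `M(z) = P(z) α(z) Φ(z) Q(z)`: `P`, `Q` are unimodular, `α = diag(z^{g₁},…,z^{g_s})`
with `g₁ ≤ … ≤ g_s`, and `Φ = diag(φ₁,…,φ_s)` with `φ_k ∣ φ_{k+1}` has no zero at zero. -/
structure SmithForm (M : Matrix (Fin s) (Fin s) (Polynomial ℝ)) where
  P : Matrix (Fin s) (Fin s) (Polynomial ℝ)
  Q : Matrix (Fin s) (Fin s) (Polynomial ℝ)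
  g : Fin s → ℕ
  phi : Fin s → Polynomial ℝ
  P_unimodular : IsUnit P.det
  Q_unimodular : IsUnit Q.det
  g_mono : Monotone g
  phi_dvd : ∀ i j, i ≤ j → phi i ∣ phi j
  phi_zero : ∀ i, (phi i).eval 0 ≠ 0
  eq : M = P * Matrix.diagonal (fun k => (Polynomial.X : Polynomial ℝ) ^ g k) *
    Matrix.diagonal phi * Q

variable {M : Matrix (Fin s) (Fin s) (Polynomial ℝ)}

/-- `ω₀`, the coefficient of `z⁰` in `Φ(z) Q(z)`. -/
def SmithForm.omega0 (F : SmithForm M) : Matrix (Fin s) (Fin s) ℝ :=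
  (Matrix.diagonal F.phi * F.Q).map fun p => p.coeff 0

/-- `𝔓_{•,•|n}`, the coefficient of `zⁿ` in `𝔓(z) = P(z)⁻¹`. -/
def SmithForm.frakCoeff (F : SmithForm M) (n : ℕ) : Matrix (Fin s) (Fin s) ℝ :=
  (F.P⁻¹).map fun p => p.coeff n

/-- `max(g_s - J, 0)`. -/
def SmithForm.excess (F : SmithForm M) (J : ℤ) : ℕ :=
  (((Finset.univ.sup F.g : ℕ) : ℤ) - J).toNat

/-- The stack of `𝔓^{1,•}, …, 𝔓^{s,•}` with `L` block columns; row `(k, i)` is the `i`-th row of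
`𝔓^{k,•}`.  With `δ_k = J - g_k` if `g_k ≤ J`, and `γ_k = g_k - J` if `g_k > J`. -/
def frakStack (F : SmithForm M) (J : ℤ) (H L : ℕ) :
    Matrix (Fin s × Fin H) (Fin L × Fin s) ℝ := fun x y =>
  if ((F.g x.1 : ℕ) : ℤ) ≤ J then
    if (x.2 : ℕ) < (J - F.g x.1).toNat then 0
    else if (y.1 : ℕ) ≤ (x.2 : ℕ) - (J - F.g x.1).toNat then
      F.frakCoeff ((x.2 : ℕ) - (J - F.g x.1).toNat - (y.1 : ℕ)) x.1 y.2
    else 0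
  else if (y.1 : ℕ) ≤ (((F.g x.1 : ℕ) : ℤ) - J).toNat + (x.2 : ℕ) then
      F.frakCoeff ((((F.g x.1 : ℕ) : ℤ) - J).toNat + (x.2 : ℕ) - (y.1 : ℕ)) x.1 y.2
    else 0

/-- The block lower triangular Toeplitz matrix with blocks `𝔓_{•,•|0}, …, 𝔓_{•,•|L-1}`. -/
def frakToeplitz (F : SmithForm M) (L : ℕ) : Matrix (Fin L × Fin s) (Fin L × Fin s) ℝ := fun x y =>
  if (y.1 : ℕ) ≤ (x.1 : ℕ) then F.frakCoeff ((x.1 : ℕ) - (y.1 : ℕ)) x.2 y.2 else 0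

/-- The permutation matrix `U`: row `(k, i)` selects the `k`-th row of the `i`-th `s`-block. -/
def Umat (s H : ℕ) : Matrix (Fin s × Fin H) (Fin H × Fin s) ℝ := fun x y =>
  if x.1 = y.2 ∧ x.2 = y.1 then 1 else 0

/-- `mᵢ,•`, the coefficient of `ε^•_{t-i}` in
`ζ_t = -∑_k ∑_j ∑_{h ≤ j} A_{kh} z^{k+j-h} ε^j_t`. -/
def mCoeff (A : Fin (K + 1) → Fin (H + 1) → Matrix (Fin s) (Fin s) ℝ) (i : ℕ) :
    Matrix (Fin s) (Fin H × Fin s) ℝ := fun r y =>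
  -∑ k : Fin (K + 1), ∑ h : Fin (H + 1),
    if (h : ℕ) ≤ (y.1 : ℕ) ∧ (k : ℕ) + (y.1 : ℕ) = i + (h : ℕ) then A k h r y.2 else 0

/-- The stack of `m₀,•, …, m_{L-1},•`. -/
def mStack (A : Fin (K + 1) → Fin (H + 1) → Matrix (Fin s) (Fin s) ℝ) (L : ℕ) :
    Matrix (Fin L × Fin s) (Fin H × Fin s) ℝ := fun x y => mCoeff A x.1 x.2 y

/-- The Moore–Penrose pseudo-inverse of a matrix of full column rank. -/
def pinv {m n : Type*} [Fintype m] [Fintype n] [DecidableEq n] (B : Matrix m n ℝ) :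
    Matrix n m ℝ := (B.transpose * B)⁻¹ * B.transpose

/-- `s₀ + ⋯ + s_i` for `γ = (s₀, …, s_H)`. -/
def cum (γ : Fin (H + 1) → ℕ) (i : ℕ) : ℕ :=
  ∑ l ∈ Finset.univ.filter (fun l : Fin (H + 1) => (l : ℕ) ≤ i), γ l

/-- The index set of the non-trivial components of `(ε⁰, …, ε^{H-1})`: the pairs `(j, c)` such that
`c` is one of the first `s₀ + ⋯ + s_j` components. -/
abbrev PIdx (s : ℕ) (γ : Fin (H + 1) → ℕ) : Type :=
  {x : Fin H × Fin s // (x.2 : ℕ) < cum γ (x.1 : ℕ)}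

/-- The matrix `R` selecting the non-trivial components. -/
def Rmat (s : ℕ) (γ : Fin (H + 1) → ℕ) : Matrix (PIdx s γ) (Fin H × Fin s) ℝ := fun x y =>
  if x.1 = y then 1 else 0

/-- The first `n` columns of a matrix. -/
def firstCols (B : Matrix (Fin s) (Fin s) ℝ) (n : ℕ) :
    Matrix (Fin s) {c : Fin s // (c : ℕ) < n} ℝ := fun r c => B r c.1

/-- The block diagonal matrix `S`, with blocks `ω₀,_{s₀+⋯+s_i}^†` for `i = 0, …, H-1`. -/
def Smat (F : SmithForm M) (γ : Fin (H + 1) → ℕ) : Matrix (PIdx s γ) (Fin H × Fin s) ℝ :=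
  fun x y => if x.1.1 = y.1 then
    pinv (firstCols F.omega0 (cum γ (x.1.1 : ℕ))) ⟨x.1.2, x.2⟩ y.2 else 0

/-- The bottom right submatrix `S₂` of `S`, without the first `d` diagonal blocks. -/
def S2mat (F : SmithForm M) (γ : Fin (H + 1) → ℕ) (d : ℕ) :
    Matrix {x : PIdx s γ // d ≤ (x.1.1 : ℕ)} (Fin (H - d) × Fin s) ℝ :=
  (Smat F γ).submatrix (fun x => x.1)
    (fun y => (⟨d + (y.1 : ℕ), by have := y.1.2; omega⟩, y.2))

/-- `S Uᵀ 𝔓` with `L` block columns. -/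
def SUP (F : SmithForm M) (J : ℤ) (γ : Fin (H + 1) → ℕ) (L : ℕ) :
    Matrix (PIdx s γ) (Fin L × Fin s) ℝ :=
  Smat F γ * (Umat s H).transpose * frakStack F J H L

/-- The constraint matrix `S Uᵀ 𝔓 (m₀,•; …; m_{L-1},•) Rᵀ`. -/
def constraintMat (A : Fin (K + 1) → Fin (H + 1) → Matrix (Fin s) (Fin s) ℝ)
    (F : SmithForm (piPoly A)) (γ : Fin (H + 1) → ℕ) (L : ℕ) :
    Matrix (PIdx s γ) (PIdx s γ) ℝ :=
  SUP F (J1 A) γ L * mStack A L * (Rmat s γ).transpose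

/-- The dimension of the right kernel of a real matrix. -/
def kerDim {m n : Type*} [Fintype n] (B : Matrix m n ℝ) : ℕ :=
  Module.finrank ℝ (LinearMap.ker B.mulVecLin)

/-- `S` is a (non-empty) affine subspace of dimension `d`. -/
def IsAffineOfDim {V : Type*} [AddCommGroup V] [Module ℝ V] (S : Set V) (d : ℕ) : Prop :=
  ∃ W : AffineSubspace ℝ V, (W : Set V) = S ∧ S.Nonempty ∧ Module.finrank ℝ W.direction = d

end Algebra

/-! ### The exogenous process, projections, revision processes -/

section Probability

variable {Ω : Type*} [MeasurableSpace Ω] {μ : Measure Ω} {s q K H : ℕ}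

/-- `H_u(t)`, the closed linear span of the components of `u_t, u_{t-1}, …`. -/
def info (u : ℤ → Fin s → Lp ℝ 2 μ) (t : ℤ) : Submodule ℝ (Lp ℝ 2 μ) :=
  (Submodule.span ℝ {x | ∃ τ : ℤ, τ ≤ t ∧ ∃ c, x = u τ c}).topologicalClosure

instance info_complete (u : ℤ → Fin s → Lp ℝ 2 μ) (t : ℤ) : CompleteSpace (info u t) :=
  (Submodule.isClosed_topologicalClosure _).completeSpace_coe

/-- `𝔼_t`, the orthogonal projection of `L²` onto `H_u(t)`. -/
def proj (u : ℤ → Fin s → Lp ℝ 2 μ) (t : ℤ) (x : Lp ℝ 2 μ) : Lp ℝ 2 μ :=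
  (info u t).starProjection x

/-- `𝔼_t - 𝔼_{t-1}`. -/
def innov (u : ℤ → Fin s → Lp ℝ 2 μ) (t : ℤ) (x : Lp ℝ 2 μ) : Lp ℝ 2 μ :=
  proj u t x - proj u (t - 1) x

/-- `x_t = ∑_{n ≥ 0} k_n ε_{t-n}` (convergence in `L²`) for all `t`. -/
def IsCausalFilter (eps : ℤ → Fin q → Lp ℝ 2 μ) (k : ℕ → Matrix (Fin s) (Fin q) ℝ)
    (x : ℤ → Fin s → Lp ℝ 2 μ) : Prop :=
  ∀ t c, HasSum (fun n : ℕ => ∑ a, k n c a • eps (t - n) a) (x t c)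

/-- `x` is a causal stationary process (jointly stationary with `u`). -/
def IsCausalStationary (eps : ℤ → Fin q → Lp ℝ 2 μ) (x : ℤ → Fin s → Lp ℝ 2 μ) : Prop :=
  ∃ k : ℕ → Matrix (Fin s) (Fin q) ℝ, IsCausalFilter eps k x

/-- `u_t = ∑ wₙ ε_{t-n}` is the Wold decomposition of the linearly regular stationary process `u`:
`ε` is a `q`-dimensional white noise whose covariance matrix has rank `q`, and
`ε_t` belongs to `H_u(t)`. -/
structure IsWold (u : ℤ → Fin s → Lp ℝ 2 μ) (eps : ℤ → Fin q → Lp ℝ 2 μ)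
    (w : ℕ → Matrix (Fin s) (Fin q) ℝ) : Prop where
  white : ∃ Sig : Matrix (Fin q) (Fin q) ℝ, Sig.rank = q ∧
    ∀ t t' a b, inner ℝ (eps t a) (eps t' b) = if t = t' then Sig a b else 0
  mem : ∀ t a, eps t a ∈ info u t
  summable : ∀ r c, Summable fun n => (w n * (w n).transpose) r c
  eq : IsCausalFilter eps w u

/-- `y` solves the rational expectations model `∑ₖ ∑ₕ A_{kh} 𝔼_{t-k}(y_{t+h-k}) = -u_t`. -/
def SolvesRE (A : Fin (K + 1) → Fin (H + 1) → Matrix (Fin s) (Fin s) ℝ)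
    (u y : ℤ → Fin s → Lp ℝ 2 μ) : Prop :=
  ∀ t r, ∑ k : Fin (K + 1), ∑ h : Fin (H + 1),
    act (A k h) (fun c => proj u (t - (k : ℕ)) (y (t + (h : ℕ) - (k : ℕ)) c)) r = -u t r

/-- `y ∈ H^Pre(t; γ)`: `y_t ∈ H_u(t)`, and the revisions `ε_t^j = (𝔼_t - 𝔼_{t-1}) y_{t+j}` vanish in
the components belonging to the subprocesses `y^{s_i}` with `i > j`. -/
def IsPredetermined (γ : Fin (H + 1) → ℕ) (u y : ℤ → Fin s → Lp ℝ 2 μ) : Prop :=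
  (∀ t c, y t c ∈ info u t) ∧
  ∀ (j : Fin H) (t : ℤ) (c : Fin s), cum γ (j : ℕ) ≤ (c : ℕ) → innov u t (y (t + (j : ℕ)) c) = 0

/-- `(ε⁰, …, ε^{H-1})` are martingale difference sequences with respect to `H_u(t)` with
`ε^{j,s_i} = 0` for `i > j`. -/
def IsPreMDS (γ : Fin (H + 1) → ℕ) (u : ℤ → Fin s → Lp ℝ 2 μ)
    (e : Fin H → ℤ → Fin s → Lp ℝ 2 μ) : Prop :=
  ∀ j t c, proj u t (e j t c) = e j t c ∧ proj u (t - 1) (e j t c) = 0 ∧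
    (cum γ (j : ℕ) ≤ (c : ℕ) → e j t c = 0)

/-- `ζ_t = -∑_k ∑_j ∑_{h ≤ j} A_{kh} ε^j_{t-(k+j-h)}`. -/
def zeta (A : Fin (K + 1) → Fin (H + 1) → Matrix (Fin s) (Fin s) ℝ)
    (e : Fin H → ℤ → Fin s → Lp ℝ 2 μ) : ℤ → Fin s → Lp ℝ 2 μ := fun t r =>
  -∑ k : Fin (K + 1), ∑ j : Fin H,
    ∑ h ∈ Finset.univ.filter (fun h : Fin (H + 1) => (h : ℕ) ≤ (j : ℕ)),
    act (A k h) (e j (t - ((k : ℕ) + (j : ℕ) - (h : ℕ) : ℤ))) r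

/-- `α(z)⁻¹ P(z)⁻¹ (ζ_{t-J₁} - u_{t-J₁})`. -/
def forcing (A : Fin (K + 1) → Fin (H + 1) → Matrix (Fin s) (Fin s) ℝ) (F : SmithForm (piPoly A))
    (u : ℤ → Fin s → Lp ℝ 2 μ) (e : Fin H → ℤ → Fin s → Lp ℝ 2 μ) : ℤ → Fin s → Lp ℝ 2 μ :=
  fun t k =>
    lagAct F.P⁻¹ (fun τ c => zeta A e (τ - J1 A) c - u (τ - J1 A) c) (t + (F.g k : ℕ)) k

/-- The constraints
`S (𝔼_{t-i} - 𝔼_{t-(i+1)}) [α(z)⁻¹ P(z)⁻¹ (ζ_{t-J₁} - u_{t-J₁})] = 0`, `i = 0, …, H-1`,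
where `S` acts on the vector stacked over `i`. -/
def Constraints (A : Fin (K + 1) → Fin (H + 1) → Matrix (Fin s) (Fin s) ℝ)
    (F : SmithForm (piPoly A)) (γ : Fin (H + 1) → ℕ) (u : ℤ → Fin s → Lp ℝ 2 μ)
    (e : Fin H → ℤ → Fin s → Lp ℝ 2 μ) : Prop :=
  ∀ t : ℤ, act (Smat F γ) (fun y : Fin H × Fin s => innov u (t - (y.1 : ℕ)) (forcing A F u e t y.2)) = 0

/-- The vector `ε_t^{p,•} = R ε_t^•` of the non-trivial components. -/
def epsP (γ : Fin (H + 1) → ℕ) (e : Fin H → ℤ → Fin s → Lp ℝ 2 μ) (t : ℤ) :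
    PIdx s γ → Lp ℝ 2 μ :=
  act (Rmat s γ) (fun y => e y.1 t y.2)

/-- `(𝔼_t - 𝔼_{t-1}) (u_t; …; u_{t+L-1})`. -/
def innovStack (u : ℤ → Fin s → Lp ℝ 2 μ) (L : ℕ) (t : ℤ) : Fin L × Fin s → Lp ℝ 2 μ :=
  fun y => innov u t (u (t + (y.1 : ℕ)) y.2)

/-- The structural difference equation
`π(z) y_t = π(z) (ε⁰_t + ε¹_{t-1} + ⋯ + ε^{H-1}_{t-H+1}) + ζ_{t-J₁} - u_{t-J₁}`. -/
def SolvesSDE (A : Fin (K + 1) → Fin (H + 1) → Matrix (Fin s) (Fin s) ℝ)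
    (u : ℤ → Fin s → Lp ℝ 2 μ) (e : Fin H → ℤ → Fin s → Lp ℝ 2 μ)
    (y : ℤ → Fin s → Lp ℝ 2 μ) : Prop :=
  ∀ t r, lagAct (piPoly A) y t r =
    lagAct (piPoly A) (fun τ c => ∑ j : Fin H, e j (τ - (j : ℕ)) c) t r
      + zeta A e (t - J1 A) r - u (t - J1 A) r

/-- The processes `ε_t^{j,s_i} = h_{j,s_i} ε_t` with coefficient matrix `X = (h_{j,s_i})`. -/
def mdsOf (γ : Fin (H + 1) → ℕ) (eps : ℤ → Fin q → Lp ℝ 2 μ) (X : Matrix (PIdx s γ) (Fin q) ℝ) :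
    Fin H → ℤ → Fin s → Lp ℝ 2 μ :=
  fun j t c => act ((Rmat s γ).transpose * X) (eps t) (j, c)

/-- The free parameters of the structural difference equation: the coefficient matrices
`X = (h_{j,s_i})` for which the processes `ε_t^{j,s_i} = h_{j,s_i} ε_t` satisfy the constraints. -/
def freeParams (A : Fin (K + 1) → Fin (H + 1) → Matrix (Fin s) (Fin s) ℝ)
    (F : SmithForm (piPoly A)) (γ : Fin (H + 1) → ℕ) (u : ℤ → Fin s → Lp ℝ 2 μ)
    (eps : ℤ → Fin q → Lp ℝ 2 μ) : Set (Matrix (PIdx s γ) (Fin q) ℝ) :=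
  {X | Constraints A F γ u (mdsOf γ eps X)}

/-- `y` is a causal stationary solution of the structural difference equation generated by `X`. -/
def Generates (A : Fin (K + 1) → Fin (H + 1) → Matrix (Fin s) (Fin s) ℝ)
    (γ : Fin (H + 1) → ℕ) (u : ℤ → Fin s → Lp ℝ 2 μ) (eps : ℤ → Fin q → Lp ℝ 2 μ)
    (X : Matrix (PIdx s γ) (Fin q) ℝ) (y : ℤ → Fin s → Lp ℝ 2 μ) : Prop :=
  IsCausalStationary eps y ∧ SolvesSDE A u (mdsOf γ eps X) y

/-- All non-zero zeros of `M(z)` lie outside the unit circle. -/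
def ZerosOutside (M : Matrix (Fin s) (Fin s) (Polynomial ℝ)) : Prop :=
  ∀ z : ℂ, z ≠ 0 → Polynomial.aeval z M.det = 0 → 1 < ‖z‖

end Probability

/-- For a matrix of full column rank `pinv` satisfies the four Penrose equations. -/
theorem pinv_penrose {m n : Type*} [Fintype m] [Fintype n] [DecidableEq n] (B : Matrix m n ℝ)
    (hB : IsUnit (B.transpose * B).det) :
    B * pinv B * B = B ∧ pinv B * B * pinv B = pinv B ∧
      (B * pinv B).transpose = B * pinv B ∧ (pinv B * B).transpose = pinv B * B := by
  have h1 : pinv B * B = 1 := by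
    unfold pinv
    rw [Matrix.mul_assoc, Matrix.nonsing_inv_mul _ hB]
  refine ⟨?_, ?_, ?_, ?_⟩
  · rw [Matrix.mul_assoc, h1, Matrix.mul_one]
  · rw [h1, Matrix.one_mul]
  · unfold pinv
    simp [Matrix.transpose_mul, Matrix.transpose_nonsing_inv, Matrix.mul_assoc]
  · rw [h1, Matrix.transpose_one]

end REM

end

/-!
The process `y` enters the difference equation only through `v_t = y_t - ε⁰_t - ⋯ - ε^{H-1}_{t-H+1}`,
and since `P` is unimodular and the forward shift is invertible on processes, the equation is
equivalent to `Φ(z) Q(z) v_t = f_t`, where `f_t = α(z)⁻¹ P(z)⁻¹ (ζ_{t-J₁} - u_{t-J₁})` is the forcing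
process (`solvesSDE_iff`). All assertions follow by comparing innovations at each time `τ`.

*Model and equation.* If `ε^j` are the revisions of `y`, then `𝔼_t y_{t+h} = y_{t+h} - ∑_{j<h} ε^j_{t+h-j}`
turns the model into the equation (`solvesRE_iff`). The revision of `v_{τ+i}` at time `τ` is the
difference between the revision of `y_{τ+i}` and `ε^i_τ`, so for revisions of `y` the first `H`
innovations of `v`, hence of the forcing process, vanish. Conversely, if `S` annihilates these innovations, then
the differences vanish one after the other, because the `i`-th block of `S` is a left inverse of the
columns of `ω₀ = Φ(0) Q(0)` that they meet (`eq_zero_of_act_Smat`). The same recursion shows that two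
free parameters with a common solution coincide (`IsWold.freeParam_unique`).

*Linear systems.* The innovation of `ζ_{τ+l}` at time `τ` is `m_{l,•} ε^•_τ`, and it vanishes for `l < 0`,
so only finitely many coefficients of `P⁻¹` contribute to the first `H` innovations of the forcing
process (`act_frakStack`); the constraints become a linear system
(`IsPreMDS.constraints_iff_stack`, `IsPreMDS.constraints_iff_toeplitz`). The components of `ε_t` being
linearly independent, it amounts to a matrix equation `C X = D` for the parameter `X`
(`IsWold.freeParams_eq`), whose solution set is `q` copies of a translate of the kernel of `C`.
When all `g_k` are equal they are zero, since `π(0) = A*_{J₁} ≠ 0`; `S₂` has full row rank and the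
Toeplitz matrix of `P⁻¹` is inverted by that of `P`, so that the rank condition makes `C` surjective.

*Causal stationary solutions.* Elements of `H_u(t)` are the sums of their innovations
(`IsWold.hasSum_innov`), so causal stationary processes are the processes with `x_t ∈ H_u(t)` that have a
transfer function. Uniqueness holds because the scalar polynomial `det π ≠ 0` annihilates the difference
of two solutions, which therefore vanishes (`IsWold.eq_zero_of_polyShift`).
For existence, the reciprocals of the `φ_k` have absolutely summable coefficients, which inverts
`Φ(z) Q(z)` on the forcing process as soon as the latter is non-anticipative
(`IsWold.generates_unique_iff`).
-/

noncomputable section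

namespace REM

/-! ### Polynomials in the shift -/

section Operators

variable {E : Type*} [AddCommGroup E] [Module ℝ E]

theorem act_mul {l m n : Type*} [Fintype m] [Fintype n] (M : Matrix l m ℝ) (N : Matrix m n ℝ)
    (x : n → E) : act (M * N) x = act M (act N x) := by
  funext r
  simp only [act, Matrix.mul_apply, Finset.sum_smul, Finset.smul_sum, smul_smul]
  exact Finset.sum_comm

theorem act_sub {m n : Type*} [Fintype n] (M : Matrix m n ℝ) (x y : n → E) :
    act M (x - y) = act M x - act M y := by
  funext r
  simp [act, smul_sub, Finset.sum_sub_distrib]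

/-- The backward shift on scalar processes. -/
def shift : Module.End ℝ (ℤ → E) where
  toFun x t := x (t - 1)
  map_add' _ _ := rfl
  map_smul' _ _ := rfl

theorem shift_pow_apply (n : ℕ) (x : ℤ → E) (t : ℤ) : (shift ^ n) x t = x (t - n) := by
  induction n generalizing t with
  | zero => simp
  | succ n ih =>
    rw [pow_succ', Module.End.mul_apply]
    change (shift ^ n) x (t - 1) = _
    rw [ih]
    congr 1
    push_cast
    ring

/-- The polynomial `p(z)` in the backward shift `z`, acting on scalar processes. -/
def polyShift (p : Polynomial ℝ) : Module.End ℝ (ℤ → E) := Polynomial.aeval shift p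

theorem polyShift_apply (p : Polynomial ℝ) (x : ℤ → E) (t : ℤ) :
    polyShift p x t = p.sum fun n a => a • x (t - n) := by
  rw [polyShift, Polynomial.aeval_eq_sum_range, Polynomial.sum_over_range _ (by simp)]
  simp [LinearMap.sum_apply, shift_pow_apply]

theorem polyShift_monomial (n : ℕ) (a : ℝ) (x : ℤ → E) (t : ℤ) :
    polyShift (Polynomial.monomial n a) x t = a • x (t - n) := by
  rw [polyShift_apply, Polynomial.sum_monomial_index _ _ (by simp)]

theorem polyShift_mul (p p' : Polynomial ℝ) (x : ℤ → E) :
    polyShift (p * p') x = polyShift p (polyShift p' x) := by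
  simp [polyShift]

theorem polyShift_sum {ι : Type*} (S : Finset ι) (p : ι → Polynomial ℝ) (x : ℤ → E) :
    polyShift (∑ i ∈ S, p i) x = ∑ i ∈ S, polyShift (p i) x := by
  simp [polyShift, LinearMap.sum_apply]

theorem polyShift_X_pow (n : ℕ) (x : ℤ → E) (t : ℤ) :
    polyShift (Polynomial.X ^ n) x t = x (t - n) := by
  simp [polyShift, shift_pow_apply]

theorem polyShift_translate (p : Polynomial ℝ) (x : ℤ → E) (a t : ℤ) :
    polyShift p (fun τ => x (τ + a)) t = polyShift p x (t + a) := by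
  simp only [polyShift_apply]
  congr 1
  funext n b
  congr 2
  ring

theorem lagAct_apply {m n : Type*} [Fintype n] (M : Matrix m n (Polynomial ℝ)) (x : ℤ → n → E)
    (t : ℤ) (r : m) : lagAct M x t r = ∑ c, polyShift (M r c) (fun τ => x τ c) t := by
  simp only [lagAct, polyShift_apply]

theorem lagAct_comp {m n : Type*} [Fintype n] (M : Matrix m n (Polynomial ℝ)) (x : ℤ → n → E)
    (r : m) : (fun t => lagAct M x t r) = ∑ c, polyShift (M r c) (fun τ => x τ c) := by
  funext t
  rw [lagAct_apply, Finset.sum_apply]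

theorem lagAct_mul {l m n : Type*} [Fintype m] [Fintype n] (M : Matrix l m (Polynomial ℝ))
    (N : Matrix m n (Polynomial ℝ)) (x : ℤ → n → E) :
    lagAct (M * N) x = lagAct M (lagAct N x) := by
  funext t r
  simp only [lagAct_apply _ _ t r, lagAct_comp, Matrix.mul_apply, polyShift_sum, polyShift_mul,
    map_sum, Finset.sum_apply]
  exact Finset.sum_comm

theorem lagAct_sub {m n : Type*} [Fintype n] (M : Matrix m n (Polynomial ℝ)) (x y : ℤ → n → E) :
    lagAct M (x - y) = lagAct M x - lagAct M y := by
  funext t r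
  simp only [lagAct_apply, Pi.sub_apply, ← Finset.sum_sub_distrib]
  refine Finset.sum_congr rfl fun c _ => ?_
  exact congrFun (map_sub (polyShift (M r c)) (fun τ => x τ c) (fun τ => y τ c)) t

theorem lagAct_zero {m n : Type*} [Fintype n] (M : Matrix m n (Polynomial ℝ)) :
    lagAct M (0 : ℤ → n → E) = 0 := by
  simpa using lagAct_sub M (0 : ℤ → n → E) 0

theorem lagAct_diagonal {n : Type*} [Fintype n] [DecidableEq n] (p : n → Polynomial ℝ)
    (x : ℤ → n → E) (t : ℤ) (r : n) :
    lagAct (Matrix.diagonal p) x t r = polyShift (p r) (fun τ => x τ r) t := by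
  rw [lagAct_apply, Finset.sum_eq_single r]
  · simp
  · intro c _ hc
    simp [Matrix.diagonal_apply_ne _ hc.symm, polyShift]
  · simp

theorem lagAct_one {n : Type*} [Fintype n] [DecidableEq n] (x : ℤ → n → E) :
    lagAct (1 : Matrix n n (Polynomial ℝ)) x = x := by
  funext t r
  rw [← Matrix.diagonal_one, lagAct_diagonal]
  simp [polyShift]

/-- A polynomial in the shift, applied to a sequence that vanishes at negative times, is a finite
convolution. -/
theorem sum_smul_eq_truncated (p : Polynomial ℝ) (b : ℤ → E) (hb : ∀ l < 0, b l = 0) (N : ℤ) (L : ℕ)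
    (hN : N < L) :
    polyShift p b N =
      ∑ l : Fin L, (if ((l : ℕ) : ℤ) ≤ N then p.coeff (N - (l : ℕ)).toNat else 0) • b (l : ℕ) := by
  induction p using Polynomial.induction_on' with
  | add p p' hp hp' =>
    have : polyShift (p + p') b N = polyShift p b N + polyShift p' b N := by simp [polyShift]
    rw [this, hp, hp', ← Finset.sum_add_distrib]
    refine Finset.sum_congr rfl fun l _ => ?_
    split_ifs <;> simp [add_smul]
  | monomial n a =>
    rw [polyShift_monomial]
    by_cases h : N - n < 0
    · rw [hb _ h, smul_zero, eq_comm]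
      refine Finset.sum_eq_zero fun l _ => ?_
      split_ifs with hl
      · rw [Polynomial.coeff_monomial, if_neg (by omega), zero_smul]
      · simp
    · rw [Finset.sum_eq_single (⟨(N - n).toNat, by omega⟩ : Fin L)]
      · have h1 : (((N - n).toNat : ℕ) : ℤ) = N - n := by omega
        rw [if_pos (by simp only; omega), Polynomial.coeff_monomial, if_pos (by simp only; omega)]
        simp only [h1]
      · intro l _ hl
        split_ifs with hl'
        · rw [Polynomial.coeff_monomial, if_neg, zero_smul]
          intro h2
          apply hl
          ext
          simp only
          omega
        · simp
      · simp

end Operators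

/-! ### The Smith form and the degrees of the matrix polynomial -/

section Algebra

variable {s K H : ℕ} {M : Matrix (Fin s) (Fin s) (Polynomial ℝ)}

theorem SmithForm.inv_mul (F : SmithForm M) : F.P⁻¹ * F.P = 1 :=
  Matrix.nonsing_inv_mul _ F.P_unimodular

theorem SmithForm.mul_inv (F : SmithForm M) : F.P * F.P⁻¹ = 1 :=
  Matrix.mul_nonsing_inv _ F.P_unimodular

/-- `Φ(z) Q(z)`. -/
def SmithForm.omega (F : SmithForm M) : Matrix (Fin s) (Fin s) (Polynomial ℝ) :=
  Matrix.diagonal F.phi * F.Q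

theorem SmithForm.isUnit_omega0 (F : SmithForm M) : IsUnit F.omega0.det := by
  have h : F.omega0 = (Polynomial.evalRingHom (0 : ℝ)).mapMatrix F.omega := by
    ext i j
    simp [omega0, omega, Polynomial.coeff_zero_eq_eval_zero]
  rw [h, ← RingHom.map_det, omega, Matrix.det_mul, map_mul, Matrix.det_diagonal, map_prod,
    isUnit_iff_ne_zero]
  refine mul_ne_zero (Finset.prod_ne_zero_iff.2 fun i _ => F.phi_zero i) ?_
  exact (F.Q_unimodular.map (Polynomial.evalRingHom (0 : ℝ))).ne_zero

/-- The first columns of the invertible matrix `ω₀` are linearly independent, so that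
the pseudo-inverse is a left inverse. -/
theorem pinv_mul_firstCols (F : SmithForm M) (n : ℕ) :
    pinv (firstCols F.omega0 n) * firstCols F.omega0 n = 1 := by
  set B := firstCols F.omega0 n
  have hinj : Function.Injective B.mulVec := by
    have h0 : Function.Injective F.omega0.mulVec :=
      Matrix.mulVec_injective_iff_isUnit.2 ((Matrix.isUnit_iff_isUnit_det _).2 F.isUnit_omega0)
    have hB : B = F.omega0.submatrix id (fun c : {c : Fin s // (c : ℕ) < n} => c.1) := rfl
    rw [Matrix.mulVec_injective_iff] at h0 ⊢
    exact h0.comp _ Subtype.val_injective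
  have hdet : IsUnit (B.transpose * B).det := by
    rw [← Matrix.isUnit_iff_isUnit_det, ← Matrix.mulVec_injective_iff_isUnit]
    intro x y hxy
    apply hinj
    have : (B.transpose * B).mulVec (x - y) = 0 := by
      rw [Matrix.mulVec_sub]; exact sub_eq_zero.2 hxy
    have h2 : B.mulVec (x - y) = 0 := by
      have := (Matrix.conjTranspose_mul_self_mulVec_eq_zero B (x - y)).1
        (by simpa [Matrix.conjTranspose_eq_transpose_of_trivial] using this)
      exact this
    rw [Matrix.mulVec_sub] at h2
    exact sub_eq_zero.1 h2
  unfold pinv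
  rw [Matrix.mul_assoc, Matrix.nonsing_inv_mul _ hdet]

variable (A : Fin (K + 1) → Fin (H + 1) → Matrix (Fin s) (Fin s) ℝ)

theorem Astar_eq_zero {i : ℤ} (hi : i < -K ∨ (H : ℤ) < i) : Astar A i = 0 := by
  unfold Astar
  refine Finset.sum_eq_zero fun k _ => Finset.sum_eq_zero fun h _ => if_neg ?_
  have := k.2
  have := h.2
  omega

theorem bddBelow_Astar : BddBelow {i | Astar A i ≠ 0} :=
  ⟨-K, fun i hi => by by_contra h; exact hi (Astar_eq_zero A (by omega))⟩

theorem bddAbove_Astar : BddAbove {i | Astar A i ≠ 0} :=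
  ⟨H, fun i hi => by by_contra h; exact hi (Astar_eq_zero A (by omega))⟩

variable {A}

theorem Astar_nonempty (hs : 0 < s) (hdet : (piPoly A).det ≠ 0) :
    {i | Astar A i ≠ 0}.Nonempty := by
  by_contra hne
  have h0 : ∀ i, Astar A i = 0 := by
    intro i
    by_contra h
    exact hne ⟨i, h⟩
  apply hdet
  have : piPoly A = 0 := by
    ext r c : 2
    simp [piPoly, h0]
  have : Nonempty (Fin s) := ⟨⟨0, hs⟩⟩
  simp [‹piPoly A = 0›]

theorem J1_le (hs : 0 < s) (hdet : (piPoly A).det ≠ 0) : J1 A ≤ H :=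
  csSup_le (Astar_nonempty hs hdet) fun i hi => by
    by_contra h
    exact hi (Astar_eq_zero A (by omega))

/-- The constant coefficient of `π` is `A*_{J₁}`, which does not vanish. -/
theorem piPoly_coeff_zero (hs : 0 < s) (hdet : (piPoly A).det ≠ 0) :
    (piPoly A).map (fun p => p.coeff 0) ≠ 0 := by
  have hmem : Astar A (J1 A) ≠ 0 := Int.csSup_mem (Astar_nonempty hs hdet) (bddAbove_Astar A)
  have hJ : J0 A ≤ J1 A := csInf_le (bddBelow_Astar A) hmem
  convert hmem using 1
  ext r c
  simp only [Matrix.map_apply, piPoly, Polynomial.finsetSum_coeff, Polynomial.coeff_monomial]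
  rw [Finset.sum_eq_single (J1 A)]
  · simp
  · intro i hi hne
    rw [Finset.mem_Icc] at hi
    rw [if_neg (by omega)]
  · intro h
    exact absurd (Finset.mem_Icc.2 ⟨hJ, le_rfl⟩) h

/-- If all `g_k` are equal, then `z^ḡ` divides `π`, whose constant coefficient is not zero. -/
theorem SmithForm.gbar_eq_zero (F : SmithForm (piPoly A)) (hs : 0 < s)
    (hdet : (piPoly A).det ≠ 0) {gbar : ℕ} (hg : ∀ k, F.g k = gbar) : gbar = 0 := by
  by_contra hne
  apply piPoly_coeff_zero hs hdet
  have h : ((piPoly A).map fun p => p.coeff 0) =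
      (Polynomial.evalRingHom (0 : ℝ)).mapMatrix (piPoly A) := by
    ext i j
    simp [Polynomial.coeff_zero_eq_eval_zero]
  rw [h, F.eq, map_mul, map_mul, map_mul]
  have h0 : (Polynomial.evalRingHom (0 : ℝ)).mapMatrix
      (Matrix.diagonal fun k => (Polynomial.X : Polynomial ℝ) ^ F.g k) = 0 := by
    ext i j
    by_cases hij : i = j
    · subst hij
      simp [hg, hne]
    · simp [hij]
  rw [h0]
  simp

variable {E : Type*} [AddCommGroup E] [Module ℝ E]

/-- `π(z) x_{t+J₁} = ∑ₖ ∑ₕ A_{kh} x_{t+h-k}`. -/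
theorem lagAct_piPoly (x : ℤ → Fin s → E) (t : ℤ) (r : Fin s) :
    lagAct (piPoly A) x (t + J1 A) r =
      ∑ k : Fin (K + 1), ∑ h : Fin (H + 1), act (A k h) (x (t + (h : ℕ) - (k : ℕ))) r := by
  -- both sides are the sum of `A*ᵢ x_{t+i}` over all `i` between `-K` and `H`
  have h1 : lagAct (piPoly A) x (t + J1 A) r =
      ∑ i ∈ Finset.Icc (J0 A) (J1 A), act (Astar A i) (x (t + i)) r := by
    simp only [lagAct_apply, piPoly, polyShift_sum, Finset.sum_apply, act]
    rw [Finset.sum_comm]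
    refine Finset.sum_congr rfl fun i hi => Finset.sum_congr rfl fun c _ => ?_
    rw [Finset.mem_Icc] at hi
    rw [polyShift_monomial]
    congr 2
    omega
  have h2 : ∑ i ∈ Finset.Icc (J0 A) (J1 A), act (Astar A i) (x (t + i)) r =
      ∑ i ∈ Finset.Icc (-K : ℤ) H, act (Astar A i) (x (t + i)) r := by
    have key : ∀ i, Astar A i ≠ 0 → i ∈ Finset.Icc (J0 A) (J1 A) ∩ Finset.Icc (-K : ℤ) H := by
      intro i hi
      rw [Finset.mem_inter, Finset.mem_Icc, Finset.mem_Icc]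
      refine ⟨⟨csInf_le (bddBelow_Astar A) hi, le_csSup (bddAbove_Astar A) hi⟩, ?_⟩
      by_contra h
      exact hi (Astar_eq_zero A (by omega))
    have zero : ∀ i, i ∉ Finset.Icc (J0 A) (J1 A) ∩ Finset.Icc (-K : ℤ) H →
        act (Astar A i) (x (t + i)) r = 0 := by
      intro i hi
      have : Astar A i = 0 := by
        by_contra h
        exact hi (key i h)
      simp [this, act]
    rw [← Finset.sum_subset Finset.inter_subset_left fun i _ hi => zero i hi,
      ← Finset.sum_subset Finset.inter_subset_right fun i _ hi => zero i hi]
  rw [h1, h2]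
  have h3 : ∀ i, act (Astar A i) (x (t + i)) r = ∑ k : Fin (K + 1), ∑ h : Fin (H + 1),
      if ((h : ℕ) : ℤ) - ((k : ℕ) : ℤ) = i then act (A k h) (x (t + i)) r else 0 := by
    intro i
    simp only [act, Astar, Matrix.sum_apply, Finset.sum_smul]
    rw [Finset.sum_comm]
    refine Finset.sum_congr rfl fun k _ => ?_
    rw [Finset.sum_comm]
    refine Finset.sum_congr rfl fun h _ => ?_
    split_ifs <;> simp
  simp only [h3]
  rw [Finset.sum_comm]
  refine Finset.sum_congr rfl fun k _ => ?_
  rw [Finset.sum_comm]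
  refine Finset.sum_congr rfl fun h _ => ?_
  have hk := k.2
  have hh := h.2
  rw [Finset.sum_ite_eq, if_pos (Finset.mem_Icc.2 (by omega)), add_sub_assoc]

end Algebra

/-! ### Innovations -/

section Hilbert

variable {Ω : Type*} [MeasurableSpace Ω] {μ : Measure Ω} {s q K H : ℕ}
  {u : ℤ → Fin s → Lp ℝ 2 μ} {eps : ℤ → Fin q → Lp ℝ 2 μ} {w : ℕ → Matrix (Fin s) (Fin q) ℝ}

theorem info_mono {t t' : ℤ} (h : t ≤ t') : info u t ≤ info u t' :=
  Submodule.topologicalClosure_mono (Submodule.span_mono fun _ ⟨τ, hτ, c, hx⟩ =>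
    ⟨τ, hτ.trans h, c, hx⟩)

theorem mem_info_self {τ t : ℤ} (h : τ ≤ t) (c : Fin s) : u τ c ∈ info u t :=
  Submodule.le_topologicalClosure _ (Submodule.subset_span ⟨τ, h, c, rfl⟩)

theorem isClosed_info (t : ℤ) : IsClosed (info u t : Set (Lp ℝ 2 μ)) :=
  Submodule.isClosed_topologicalClosure _

/-- `𝔼_t - 𝔼_{t-1}` as a continuous linear map. -/
def innovL (u : ℤ → Fin s → Lp ℝ 2 μ) (t : ℤ) : Lp ℝ 2 μ →L[ℝ] Lp ℝ 2 μ :=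
  (info u t).starProjection - (info u (t - 1)).starProjection

theorem innovL_apply (t : ℤ) (x : Lp ℝ 2 μ) : innovL u t x = innov u t x := rfl

theorem innov_sub (t : ℤ) (x y : Lp ℝ 2 μ) : innov u t (x - y) = innov u t x - innov u t y :=
  map_sub (innovL u t) x y

theorem innov_add (t : ℤ) (x y : Lp ℝ 2 μ) : innov u t (x + y) = innov u t x + innov u t y :=
  map_add (innovL u t) x y

theorem innov_neg (t : ℤ) (x : Lp ℝ 2 μ) : innov u t (-x) = -innov u t x :=
  map_neg (innovL u t) x

theorem innov_smul (t : ℤ) (a : ℝ) (x : Lp ℝ 2 μ) : innov u t (a • x) = a • innov u t x :=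
  map_smul (innovL u t) a x

theorem innov_sum {ι : Type*} (S : Finset ι) (t : ℤ) (x : ι → Lp ℝ 2 μ) :
    innov u t (∑ i ∈ S, x i) = ∑ i ∈ S, innov u t (x i) :=
  map_sum (innovL u t) x S

theorem innov_act {m n : Type*} [Fintype n] (B : Matrix m n ℝ) (t : ℤ) (x : n → Lp ℝ 2 μ) (r : m) :
    innov u t (act B x r) = act B (fun c => innov u t (x c)) r := by
  simp only [act, innov_sum, innov_smul]

theorem innov_polyShift (p : Polynomial ℝ) (t : ℤ) (x : ℤ → Lp ℝ 2 μ) (τ : ℤ) :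
    innov u t (polyShift p x τ) = polyShift p (fun σ => innov u t (x σ)) τ := by
  simp only [polyShift_apply, Polynomial.sum, innov_sum, innov_smul]

theorem proj_eq_self {t : ℤ} {x : Lp ℝ 2 μ} (hx : x ∈ info u t) : proj u t x = x :=
  Submodule.starProjection_eq_self_iff.2 hx

theorem innov_eq_zero {τ t : ℤ} (h : τ < t) {x : Lp ℝ 2 μ} (hx : x ∈ info u τ) :
    innov u t x = 0 := by
  rw [innov, proj_eq_self (info_mono h.le hx), proj_eq_self (info_mono (by omega) hx), sub_self]

theorem proj_mem (t : ℤ) (x : Lp ℝ 2 μ) : proj u t x ∈ info u t :=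
  Submodule.starProjection_apply_mem _ _

theorem innov_mem (t : ℤ) (x : Lp ℝ 2 μ) : innov u t x ∈ info u t :=
  Submodule.sub_mem _ (proj_mem t x) (info_mono (by omega) (proj_mem (t - 1) x))

theorem proj_eq_zero_iff {t : ℤ} {x : Lp ℝ 2 μ} : proj u t x = 0 ↔ x ∈ (info u t)ᗮ :=
  Submodule.starProjection_apply_eq_zero_iff _

/-- `x` belongs to `H_u(t)` and is orthogonal to `H_u(t-1)`. -/
def IsInnovation (u : ℤ → Fin s → Lp ℝ 2 μ) (t : ℤ) (x : Lp ℝ 2 μ) : Prop :=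
  x ∈ info u t ∧ x ∈ (info u (t - 1))ᗮ

theorem IsInnovation.innov_eq {t τ : ℤ} {x : Lp ℝ 2 μ} (hx : IsInnovation u τ x) :
    innov u t x = if t = τ then x else 0 := by
  split_ifs with h
  · subst h
    rw [innov, proj_eq_self hx.1, proj_eq_zero_iff.2 hx.2, sub_zero]
  · rcases lt_or_gt_of_ne h with h | h
    · have h1 : ∀ σ ≤ τ - 1, proj u σ x = 0 := fun σ hσ =>
        proj_eq_zero_iff.2 (Submodule.orthogonal_le (info_mono hσ) hx.2)
      rw [innov, h1 _ (by omega), h1 _ (by omega), sub_zero]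
    · exact innov_eq_zero h hx.1

theorem innov_mem_orthogonal (t : ℤ) (x : Lp ℝ 2 μ) : innov u t x ∈ (info u (t - 1))ᗮ := by
  have h : innov u t x = (x - proj u (t - 1) x) - (x - proj u t x) := by
    rw [innov]
    abel
  rw [h]
  exact Submodule.sub_mem _ (Submodule.sub_starProjection_mem_orthogonal _)
    (Submodule.orthogonal_le (info_mono (by omega))
      (Submodule.sub_starProjection_mem_orthogonal _))

theorem inner_innov_innov {t τ : ℤ} (h : t ≠ τ) (x y : Lp ℝ 2 μ) :
    inner ℝ (innov u t x) (innov u τ y) = 0 := by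
  rcases lt_or_gt_of_ne h with h | h
  · exact (innov_mem_orthogonal τ y) _ (info_mono (by omega) (innov_mem t x))
  · rw [real_inner_comm]
    exact (innov_mem_orthogonal t x) _ (info_mono (by omega) (innov_mem τ y))

/-- Sum of the innovations of `x` at the times `t, …, t-N+1`. -/
theorem sum_range_innov (t : ℤ) (x : Lp ℝ 2 μ) (N : ℕ) :
    ∑ n ∈ Finset.range N, innov u (t - (n : ℕ)) x = proj u t x - proj u (t - N) x := by
  induction N with
  | zero => simp
  | succ N ih =>
    rw [Finset.sum_range_succ, ih, innov]
    push_cast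
    rw [← sub_sub]
    abel

/-- The white noise vectors are innovations of `u`. -/
theorem IsWold.isInnovation (hu : IsWold u eps w) (t : ℤ) (a : Fin q) :
    IsInnovation u t (eps t a) := by
  refine ⟨hu.mem t a, ?_⟩
  obtain ⟨Sig, -, hS⟩ := hu.white
  have h1 : ∀ τ ≤ t - 1, ∀ c, u τ c ∈ (Submodule.span ℝ {eps t a})ᗮ := by
    intro τ hτ c
    rw [Submodule.mem_orthogonal_singleton_iff_inner_right]
    have h2 := (hu.eq τ c).mapL (innerSL ℝ (eps t a))
    have h3 : ∀ n : ℕ, innerSL ℝ (eps t a) (∑ b, w n c b • eps (τ - n) b) = 0 := by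
      intro n
      rw [map_sum]
      refine Finset.sum_eq_zero fun b _ => ?_
      rw [map_smul, innerSL_apply_apply, hS, if_neg (by omega), smul_zero]
    simp only [h3] at h2
    exact (h2.unique hasSum_zero)
  have h2 : info u (t - 1) ≤ (Submodule.span ℝ {eps t a})ᗮ := by
    refine Submodule.topologicalClosure_minimal _ ?_ (Submodule.isClosed_orthogonal _)
    rw [Submodule.span_le]
    rintro x ⟨τ, hτ, c, rfl⟩
    exact h1 τ hτ c
  rw [Submodule.mem_orthogonal]
  intro x hx
  rw [real_inner_comm]
  exact Submodule.mem_orthogonal_singleton_iff_inner_right.1 (h2 hx)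

theorem IsWold.innov_eps (hu : IsWold u eps w) (t τ : ℤ) (a : Fin q) :
    innov u t (eps τ a) = if t = τ then eps τ a else 0 :=
  (hu.isInnovation τ a).innov_eq

/-- The covariance matrix of `ε` being regular, the components of `ε_t` are linearly independent. -/
theorem IsWold.linearIndependent (hu : IsWold u eps w) (t : ℤ) : LinearIndependent ℝ (eps t) := by
  obtain ⟨Sig, hrank, hS⟩ := hu.white
  rw [Fintype.linearIndependent_iff]
  intro g hg
  have h1 : Matrix.vecMul g Sig = 0 := by
    funext b
    have : inner ℝ (∑ a, g a • eps t a) (eps t b) = 0 := by rw [hg, inner_zero_left]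
    simpa [sum_inner, real_inner_smul_left, hS, Matrix.vecMul, dotProduct] using this
  have hunit : IsUnit Sig := by
    rw [← Matrix.mulVec_surjective_iff_isUnit]
    have : LinearMap.range Sig.mulVecLin = ⊤ := by
      apply Submodule.eq_top_of_finrank_eq
      rw [← Matrix.rank, hrank]
      simp
    exact LinearMap.range_eq_top.1 this
  have := Matrix.vecMul_injective_iff_isUnit.2 hunit (h1.trans (Matrix.zero_vecMul Sig).symm)
  exact fun i => congrFun this i

/-- Linear regularity: the remote past of an element of `H_u(t)` vanishes. -/
theorem IsWold.tendsto_proj (hu : IsWold u eps w) (t : ℤ) {x : Lp ℝ 2 μ} (hx : x ∈ info u t) :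
    Filter.Tendsto (fun N : ℕ => proj u (t - N) x) Filter.atTop (nhds 0) := by
  -- the vectors with this property form a closed subspace, as projections are contractions
  let V : Submodule ℝ (Lp ℝ 2 μ) :=
    { carrier := {x | Filter.Tendsto (fun N : ℕ => proj u (t - N) x) Filter.atTop (nhds 0)}
      add_mem' := fun {a b} ha hb => by
        have := Filter.Tendsto.add ha hb
        simpa [proj, map_add] using this
      zero_mem' := by simp [proj]
      smul_mem' := fun c x hx => by
        have := Filter.Tendsto.const_smul hx c
        simpa [proj, map_smul] using this }
  have hVc : IsClosed (V : Set (Lp ℝ 2 μ)) := by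
    rw [← closure_subset_iff_isClosed]
    intro x hx
    change Filter.Tendsto _ _ _
    rw [Metric.tendsto_atTop]
    intro ε hε
    obtain ⟨y, hy, hxy⟩ := Metric.mem_closure_iff.1 hx (ε / 2) (by positivity)
    obtain ⟨N, hN⟩ := (Metric.tendsto_atTop.1 (show Filter.Tendsto _ _ _ from hy)) (ε / 2)
      (by positivity)
    refine ⟨N, fun n hn => ?_⟩
    have h1 := hN n hn
    rw [dist_zero_right] at h1 ⊢
    have h2 : proj u (t - n) x = proj u (t - n) (x - y) + proj u (t - n) y := by
      simp [proj, map_sub]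
    have h3 : ‖proj u (t - n) (x - y)‖ ≤ ‖x - y‖ := Submodule.norm_starProjection_apply_le _ _
    rw [dist_eq_norm] at hxy
    rw [h2]
    exact (norm_add_le _ _).trans_lt (by linarith)
  have heps : ∀ τ a, eps τ a ∈ V := by
    intro τ a
    change Filter.Tendsto _ _ _
    refine tendsto_const_nhds.congr' ?_
    filter_upwards [Filter.eventually_ge_atTop (t - τ + 1).toNat] with N hN
    exact (proj_eq_zero_iff.2 (Submodule.orthogonal_le (info_mono (by omega))
      (hu.isInnovation τ a).2)).symm
  have hle : info u t ≤ V := by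
    refine Submodule.topologicalClosure_minimal _ ?_ hVc
    rw [Submodule.span_le]
    rintro _ ⟨τ, -, c, rfl⟩
    refine hVc.mem_of_tendsto (hu.eq τ c) (Filter.Eventually.of_forall fun F => ?_)
    exact V.sum_mem fun n _ => V.sum_mem fun b _ => V.smul_mem _ (heps _ _)
  exact hle hx

/-- Every element of `H_u(t)` is the sum of its innovations. -/
theorem IsWold.hasSum_innov (hu : IsWold u eps w) {t : ℤ} {x : Lp ℝ 2 μ} (hx : x ∈ info u t) :
    HasSum (fun n : ℕ => innov u (t - n) x) x := by
  have hpart : ∀ N : ℕ, ∑ n ∈ Finset.range N, innov u (t - (n : ℕ)) x = x - proj u (t - N) x :=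
    fun N => by rw [sum_range_innov, proj_eq_self hx]
  have horth : OrthogonalFamily ℝ (fun n : ℕ => (ℝ ∙ innov u (t - n) x : Submodule ℝ (Lp ℝ 2 μ)))
      (fun n => (ℝ ∙ innov u (t - n) x : Submodule ℝ (Lp ℝ 2 μ)).subtypeₗᵢ) := by
    refine OrthogonalFamily.of_pairwise fun m n hmn => ?_
    rw [Function.onFun, Submodule.isOrtho_span]
    intro a ha b hb
    rw [Set.mem_singleton_iff] at ha hb
    subst ha hb
    exact inner_innov_innov (by omega) x x
  let f : ∀ n : ℕ, (ℝ ∙ innov u (t - n) x : Submodule ℝ (Lp ℝ 2 μ)) := fun n =>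
    ⟨innov u (t - n) x, Submodule.mem_span_singleton_self _⟩
  have hsum : Summable fun n : ℕ => innov u (t - n) x := by
    have := (horth.summable_iff_norm_sq_summable f).2 ?_
    · exact this
    refine summable_of_sum_range_le (c := (‖x‖ + ‖x‖) ^ 2) (fun n => by positivity) fun N => ?_
    have h1 := horth.norm_sum f (Finset.range N)
    rw [← h1]
    change ‖∑ n ∈ Finset.range N, innov u (t - (n : ℕ)) x‖ ^ 2 ≤ _
    rw [hpart]
    gcongr
    refine (norm_sub_le _ _).trans ?_
    gcongr
    exact Submodule.norm_starProjection_apply_le _ _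
  rw [hsum.hasSum_iff_tendsto_nat]
  simp only [hpart]
  simpa using (tendsto_const_nhds (x := x)).sub (hu.tendsto_proj t hx)

theorem IsWold.eq_zero_of_innov (hu : IsWold u eps w) {t : ℤ} {x : Lp ℝ 2 μ} (hx : x ∈ info u t)
    (h : ∀ n : ℕ, innov u (t - n) x = 0) : x = 0 := by
  have := hu.hasSum_innov hx
  simp only [h] at this
  exact this.unique hasSum_zero

theorem polyShift_mem_info (p : Polynomial ℝ) {x : ℤ → Lp ℝ 2 μ} {t : ℤ}
    (hx : ∀ τ ≤ t, x τ ∈ info u t) : polyShift p x t ∈ info u t := by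
  rw [polyShift_apply]
  exact Submodule.sum_mem _ fun n _ => Submodule.smul_mem _ _ (hx _ (by omega))

/-- A process with `x_t ∈ H_u(t)` that satisfies a scalar difference equation `p(z) x = 0`, `p ≠ 0`,
vanishes. -/
theorem IsWold.eq_zero_of_polyShift (hu : IsWold u eps w) {p : Polynomial ℝ} (hp : p ≠ 0)
    {x : ℤ → Lp ℝ 2 μ} (hx : ∀ t, x t ∈ info u t) (h : polyShift p x = 0) : x = 0 := by
  -- write `p = z^m p'` with `p'(0) ≠ 0`
  obtain ⟨p', hpp, hp'⟩ := Polynomial.exists_eq_pow_rootMultiplicity_mul_and_not_dvd p hp 0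
  rw [Polynomial.C_0, sub_zero] at hpp hp'
  rw [Polynomial.X_dvd_iff] at hp'
  have h' : polyShift p' x = 0 := by
    rw [hpp, polyShift_mul] at h
    funext t
    have := congrFun h (t + (p.rootMultiplicity 0 : ℕ))
    rwa [polyShift_X_pow, add_sub_cancel_right] at this
  have key : ∀ n : ℕ, ∀ t, innov u (t - n) (x t) = 0 := by
    intro n
    induction n using Nat.strong_induction_on with
    | _ n ih =>
      intro t
      have h1 : innov u (t - n) (polyShift p' x t) = p'.coeff 0 • innov u (t - n) (x t) := by
        rw [polyShift_apply, Polynomial.sum_over_range _ (by simp), innov_sum,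
          Finset.sum_eq_single 0]
        · simp [innov_smul]
        · intro j _ hj
          rw [innov_smul]
          rcases lt_or_ge n j with hnj | hnj
          · rw [innov_eq_zero (by omega) (hx _), smul_zero]
          · have := ih (n - j) (by omega) (t - j)
            rw [show t - (j : ℤ) - ((n - j : ℕ) : ℤ) = t - n by omega] at this
            rw [this, smul_zero]
        · simp
      rw [h', Pi.zero_apply, ← innovL_apply, map_zero, eq_comm, smul_eq_zero] at h1
      exact h1.resolve_left hp'
  funext t
  exact hu.eq_zero_of_innov (hx t) fun n => key n t

/-! ### Transfer functions of causal stationary processes -/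

/-- The scalar process `x` satisfies `x_t ∈ H_u(t)` and has the transfer function `k(z)`:
its innovation at time `t - n` is `kₙ ε_{t-n}`. -/
def HasTransfer (u : ℤ → Fin s → Lp ℝ 2 μ) (eps : ℤ → Fin q → Lp ℝ 2 μ) (x : ℤ → Lp ℝ 2 μ)
    (k : Fin q → PowerSeries ℝ) : Prop :=
  ∀ t, x t ∈ info u t ∧
    ∀ n : ℕ, innov u (t - n) (x t) = ∑ b, PowerSeries.coeff n (k b) • eps (t - n) b

theorem IsWold.hasTransfer_of_filter (hu : IsWold u eps w) {k : ℕ → Matrix (Fin s) (Fin q) ℝ}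
    {x : ℤ → Fin s → Lp ℝ 2 μ} (hx : IsCausalFilter eps k x) (c : Fin s) :
    HasTransfer u eps (fun t => x t c) fun b => PowerSeries.mk fun n => k n c b := by
  intro t
  refine ⟨(isClosed_info t).mem_of_tendsto (hx t c) (Filter.Eventually.of_forall fun F => ?_), ?_⟩
  · exact Submodule.sum_mem _ fun n _ => Submodule.sum_mem _ fun b _ => Submodule.smul_mem _ _
      (info_mono (by omega) (hu.mem _ b))
  · intro n
    have h1 := (hx t c).mapL (innovL u (t - n))
    have h2 : ∀ m : ℕ, m ≠ n → innovL u (t - n) (∑ a, k m c a • eps (t - m) a) = 0 := by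
      intro m hm
      rw [map_sum]
      refine Finset.sum_eq_zero fun b _ => ?_
      rw [map_smul, innovL_apply, hu.innov_eps, if_neg (by omega), smul_zero]
    have h3 := h1.unique (hasSum_single n h2)
    rw [innovL_apply] at h3
    rw [h3, map_sum]
    refine Finset.sum_congr rfl fun b _ => ?_
    rw [map_smul, innovL_apply, hu.innov_eps, if_pos rfl, PowerSeries.coeff_mk]

theorem IsCausalStationary.mem_info (hu : IsWold u eps w) {x : ℤ → Fin s → Lp ℝ 2 μ}
    (hx : IsCausalStationary eps x) (t : ℤ) (c : Fin s) : x t c ∈ info u t := by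
  obtain ⟨k, hk⟩ := hx
  exact (hu.hasTransfer_of_filter hk c t).1

theorem IsWold.isCausalStationary (hu : IsWold u eps w) {x : ℤ → Fin s → Lp ℝ 2 μ}
    {k : Fin s → Fin q → PowerSeries ℝ}
    (hx : ∀ c, HasTransfer u eps (fun t => x t c) (k c)) : IsCausalStationary eps x := by
  refine ⟨fun n c b => PowerSeries.coeff n (k c b), fun t c => ?_⟩
  have := hu.hasSum_innov (hx c t).1
  simpa only [(hx c t).2] using this

theorem IsWold.eq_of_hasTransfer (hu : IsWold u eps w) {x y : ℤ → Lp ℝ 2 μ}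
    {k : Fin q → PowerSeries ℝ} (hx : HasTransfer u eps x k) (hy : HasTransfer u eps y k) :
    x = y := by
  funext t
  refine sub_eq_zero.1 (hu.eq_zero_of_innov (Submodule.sub_mem _ (hx t).1 (hy t).1) fun n => ?_)
  rw [innov_sub, (hx t).2, (hy t).2, sub_self]

theorem IsWold.hasTransfer_eps (hu : IsWold u eps w) (a : Fin q) :
    HasTransfer u eps (fun t => eps t a) fun b => if b = a then 1 else 0 := by
  refine fun t => ⟨hu.mem t a, fun n => ?_⟩
  rw [hu.innov_eps, Finset.sum_eq_single a (fun b _ hb => by simp [hb]) (by simp)]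
  rcases Nat.eq_zero_or_pos n with rfl | hn
  · simp
  · simp [PowerSeries.coeff_one, hn.ne']

theorem HasTransfer.exists_of_eq {x y : ℤ → Lp ℝ 2 μ} {k : Fin q → PowerSeries ℝ}
    (hx : HasTransfer u eps x k) (hyx : y = x) : ∃ k, HasTransfer u eps y k :=
  ⟨k, hyx ▸ hx⟩

theorem HasTransfer.zero : HasTransfer u eps 0 0 :=
  fun t => ⟨Submodule.zero_mem _, fun n => by simp [← innovL_apply]⟩

theorem HasTransfer.add {x y : ℤ → Lp ℝ 2 μ} {k l : Fin q → PowerSeries ℝ}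
    (hx : HasTransfer u eps x k) (hy : HasTransfer u eps y l) :
    HasTransfer u eps (x + y) (k + l) :=
  fun t => ⟨Submodule.add_mem _ (hx t).1 (hy t).1, fun n => by
    simp only [Pi.add_apply, innov_add, (hx t).2, (hy t).2, map_add, add_smul,
      Finset.sum_add_distrib]⟩

theorem HasTransfer.smul {x : ℤ → Lp ℝ 2 μ} {k : Fin q → PowerSeries ℝ} (a : ℝ)
    (hx : HasTransfer u eps x k) : HasTransfer u eps (a • x) (a • k) :=
  fun t => ⟨Submodule.smul_mem _ _ (hx t).1, fun n => by
    simp only [Pi.smul_apply, innov_smul, (hx t).2, Finset.smul_sum, smul_smul, map_smul,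
      smul_eq_mul]⟩

theorem HasTransfer.delay {x : ℤ → Lp ℝ 2 μ} {k : Fin q → PowerSeries ℝ} (m : ℕ)
    (hx : HasTransfer u eps x k) :
    HasTransfer u eps (fun t => x (t - m)) fun b => PowerSeries.X ^ m * k b := by
  refine fun t => ⟨info_mono (by omega) (hx _).1, fun n => ?_⟩
  simp only [PowerSeries.coeff_X_pow_mul']
  split_ifs with h
  · have := (hx (t - m)).2 (n - m)
    rwa [show t - (m : ℤ) - ((n - m : ℕ) : ℤ) = t - n by omega] at this
  · rw [innov_eq_zero (by omega) (hx (t - m)).1]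
    simp

theorem HasTransfer.sum {ι : Type*} (S : Finset ι) {x : ι → ℤ → Lp ℝ 2 μ}
    {k : ι → Fin q → PowerSeries ℝ} (hx : ∀ i ∈ S, HasTransfer u eps (x i) (k i)) :
    HasTransfer u eps (∑ i ∈ S, x i) (∑ i ∈ S, k i) := by
  classical
  induction S using Finset.induction_on with
  | empty => simpa using HasTransfer.zero
  | insert a S ha ih =>
    rw [Finset.sum_insert ha, Finset.sum_insert ha]
    exact (hx a (Finset.mem_insert_self _ _)).add
      (ih fun i hi => hx i (Finset.mem_insert_of_mem hi))

theorem HasTransfer.exists_sum {ι : Type*} (S : Finset ι) {x : ι → ℤ → Lp ℝ 2 μ}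
    (hx : ∀ i ∈ S, ∃ k, HasTransfer u eps (x i) k) :
    ∃ k, HasTransfer u eps (fun t => ∑ i ∈ S, x i t) k := by
  choose! k hk using hx
  exact (HasTransfer.sum S hk).exists_of_eq (by funext t; simp)

theorem HasTransfer.polyShift {x : ℤ → Lp ℝ 2 μ} {k : Fin q → PowerSeries ℝ} (p : Polynomial ℝ)
    (hx : HasTransfer u eps x k) :
    HasTransfer u eps (polyShift p x) fun b => (p : PowerSeries ℝ) * k b := by
  induction p using Polynomial.induction_on' with
  | add p p' hp hp' =>
    have h1 := hp.add hp'
    have h2 : REM.polyShift (p + p') x = REM.polyShift p x + REM.polyShift p' x := by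
      simp [REM.polyShift]
    rw [h2]
    convert h1 using 1
    funext b
    simp [add_mul]
  | monomial n a =>
    have h1 := (hx.delay n).smul a
    convert h1 using 1
    · funext t
      rw [polyShift_monomial, Pi.smul_apply]
    · funext b
      rw [← Polynomial.C_mul_X_pow_eq_monomial, Polynomial.coe_mul, Polynomial.coe_C,
        Polynomial.coe_pow, Polynomial.coe_X, mul_assoc, Pi.smul_apply, PowerSeries.smul_eq_C_mul]

theorem HasTransfer.lagAct {m n : Type*} [Fintype n] (B : Matrix m n (Polynomial ℝ))
    {x : ℤ → n → Lp ℝ 2 μ} (hx : ∀ c, ∃ k, HasTransfer u eps (fun t => x t c) k) (r : m) :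
    ∃ k, HasTransfer u eps (fun t => lagAct B x t r) k := by
  choose k hk using hx
  rw [lagAct_comp]
  exact ⟨_, HasTransfer.sum _ fun c _ => (hk c).polyShift (B r c)⟩

/-- The norm of a component of a causal stationary process does not depend on time. -/
theorem IsWold.norm_eq (hu : IsWold u eps w) {x : ℤ → Lp ℝ 2 μ} {k : Fin q → PowerSeries ℝ}
    (hx : HasTransfer u eps x k) (t : ℤ) : ‖x t‖ = ‖x 0‖ := by
  obtain ⟨Sig, -, hS⟩ := hu.white
  have h1 : ∀ τ, HasSum (fun n : ℕ => ∑ b, PowerSeries.coeff n (k b) • eps (τ - n) b) (x τ) := by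
    intro τ
    have := hu.hasSum_innov (hx τ).1
    simpa only [(hx τ).2] using this
  have h2 : ∀ (τ : ℤ) (S : Finset ℕ),
      ‖∑ n ∈ S, ∑ b, PowerSeries.coeff n (k b) • eps (τ - n) b‖ ^ 2 =
      ∑ n ∈ S, ∑ b, ∑ n' ∈ S, ∑ b', PowerSeries.coeff n (k b) * (PowerSeries.coeff n' (k b') *
        if n = n' then Sig b' b else 0) := by
    intro τ S
    rw [← real_inner_self_eq_norm_sq]
    simp only [sum_inner, inner_sum, real_inner_smul_left, real_inner_smul_right, hS]
    refine Finset.sum_congr rfl fun n _ => Finset.sum_congr rfl fun b _ =>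
      Finset.sum_congr rfl fun n' _ => Finset.sum_congr rfl fun b' _ => ?_
    by_cases h : n = n'
    · simp [h]
    · rw [if_neg h, if_neg (by omega)]
  have h3 : ∀ τ, Filter.Tendsto (fun S : Finset ℕ =>
      ‖∑ n ∈ S, ∑ b, PowerSeries.coeff n (k b) • eps (τ - n) b‖ ^ 2) Filter.atTop
        (nhds (‖x τ‖ ^ 2)) := fun τ => ((h1 τ).norm).pow 2
  simp only [h2] at h3
  have h4 := tendsto_nhds_unique (h3 t) (h3 0)
  exact (sq_eq_sq₀ (norm_nonneg _) (norm_nonneg _)).1 h4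

/-- A translate, possibly into the future, of a process with a transfer function has a transfer
function if it is non-anticipative. -/
theorem HasTransfer.translate {x : ℤ → Lp ℝ 2 μ} {k : Fin q → PowerSeries ℝ}
    (hx : HasTransfer u eps x k) (m : ℤ) (hm : ∀ t, x (t + m) ∈ info u t) :
    ∃ l, HasTransfer u eps (fun t => x (t + m)) l := by
  refine ⟨fun b => PowerSeries.mk fun n =>
    if 0 ≤ (n : ℤ) + m then PowerSeries.coeff ((n : ℤ) + m).toNat (k b) else 0,
    fun t => ⟨hm t, fun n => ?_⟩⟩
  simp only [PowerSeries.coeff_mk]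
  split_ifs with h
  · have := (hx (t + m)).2 ((n : ℤ) + m).toNat
    rwa [show t + m - ((((n : ℤ) + m).toNat : ℕ) : ℤ) = t - n by omega] at this
  · rw [innov_eq_zero (by omega) (hx (t + m)).1]
    simp

end Hilbert

/-! ### Index sets -/

section Counting

variable {s H : ℕ} {γ : Fin (H + 1) → ℕ}

theorem cum_le (hγ : ∑ i, γ i = s) (i : ℕ) : cum γ i ≤ s :=
  hγ ▸ Finset.sum_le_sum_of_subset (Finset.filter_subset _ _)

theorem card_filter_le_fin (H m : ℕ) :
    (Finset.univ.filter fun j : Fin H => m ≤ (j : ℕ)).card = H - m := by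
  rw [Finset.card_filter, Fin.sum_univ_eq_sum_range (fun j => if m ≤ j then 1 else 0) H,
    ← Finset.card_filter, ← Nat.card_Ico]
  congr 1
  ext j
  simp [and_comm]

theorem card_filter_lt_fin {s n : ℕ} (h : n ≤ s) :
    (Finset.univ.filter fun c : Fin s => (c : ℕ) < n).card = n := by
  rw [Finset.card_filter, Fin.sum_univ_eq_sum_range (fun j => if j < n then 1 else 0) s,
    ← Finset.card_filter]
  conv_rhs => rw [← Finset.card_range n]
  congr 1
  ext j
  simp only [Finset.mem_filter, Finset.mem_range]
  omega

theorem card_PIdx_ge (hγ : ∑ i, γ i = s) (d : ℕ) :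
    Fintype.card {x : PIdx s γ // d ≤ (x.1.1 : ℕ)} =
      ∑ i : Fin (H + 1), γ i * (H - max d (i : ℕ)) := by
  rw [Fintype.card_congr (Equiv.subtypeSubtypeEquivSubtypeInter
    (fun x : Fin H × Fin s => (x.2 : ℕ) < cum γ (x.1 : ℕ)) fun x => d ≤ (x.1 : ℕ)),
    Fintype.card_subtype, Finset.card_filter, Fintype.sum_prod_type]
  have h1 : ∀ j : Fin H, (∑ c : Fin s, if (c : ℕ) < cum γ j ∧ d ≤ (j : ℕ) then 1 else 0) =
      ∑ i : Fin (H + 1), if max d (i : ℕ) ≤ (j : ℕ) then γ i else 0 := by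
    intro j
    by_cases hd : d ≤ (j : ℕ)
    · simp only [hd, and_true, max_le_iff, true_and]
      rw [← Finset.card_filter, card_filter_lt_fin (cum_le hγ _), cum, Finset.sum_filter]
    · simp [hd]
  simp only [h1]
  rw [Finset.sum_comm]
  refine Finset.sum_congr rfl fun i _ => ?_
  rw [← Finset.sum_filter, Finset.sum_const, card_filter_le_fin, smul_eq_mul, mul_comm]

theorem card_PIdx (hγ : ∑ i, γ i = s) :
    Fintype.card (PIdx s γ) = ∑ i : Fin (H + 1), γ i * (H - (i : ℕ)) := by
  rw [← Fintype.card_congr (Equiv.subtypeUnivEquiv (p := fun x : PIdx s γ => 0 ≤ (x.1.1 : ℕ))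
    fun x => Nat.zero_le _), card_PIdx_ge hγ]
  simp

theorem card_PIdx_ge_split (hγ : ∑ i, γ i = s) (d : ℕ) :
    Fintype.card {x : PIdx s γ // d ≤ (x.1.1 : ℕ)} =
      (H - d) * (∑ i ∈ Finset.univ.filter (fun i : Fin (H + 1) => (i : ℕ) < d), γ i)
        + ∑ i ∈ Finset.univ.filter (fun i : Fin (H + 1) => d ≤ (i : ℕ)), γ i * (H - (i : ℕ)) := by
  rw [card_PIdx_ge hγ, ← Finset.sum_filter_add_sum_filter_not _ fun i : Fin (H + 1) => (i : ℕ) < d]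
  simp only [not_lt]
  congr 1
  · rw [Finset.mul_sum]
    refine Finset.sum_congr rfl fun i hi => ?_
    rw [max_eq_left (Finset.mem_filter.1 hi).2.le, mul_comm]
  · refine Finset.sum_congr rfl fun i hi => ?_
    rw [max_eq_right (Finset.mem_filter.1 hi).2]

theorem card_PIdx_sub (hγ : ∑ i, γ i = s) {d : ℕ} (hd : d ≤ H) :
    Fintype.card (PIdx s γ) = Fintype.card {x : PIdx s γ // d ≤ (x.1.1 : ℕ)} +
      ∑ i ∈ Finset.univ.filter (fun i : Fin (H + 1) => (i : ℕ) < d), γ i * (d - (i : ℕ)) := by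
  rw [card_PIdx hγ, card_PIdx_ge hγ, Finset.sum_filter, ← Finset.sum_add_distrib]
  refine Finset.sum_congr rfl fun i _ => ?_
  split_ifs with h
  · rw [max_eq_left h.le, ← mul_add]
    congr 1
    omega
  · rw [max_eq_right (by omega), add_zero]

end Counting

/-! ### Matrices acting on stacked vectors -/

section Stacks

variable {s K H : ℕ} {M : Matrix (Fin s) (Fin s) (Polynomial ℝ)} {γ : Fin (H + 1) → ℕ}
  {E : Type*} [AddCommGroup E] [Module ℝ E]

theorem act_Smat (F : SmithForm M) (f : Fin H × Fin s → E) (x : PIdx s γ) :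
    act (Smat F γ) f x =
      act (pinv (firstCols F.omega0 (cum γ x.1.1))) (fun c => f (x.1.1, c)) ⟨x.1.2, x.2⟩ := by
  simp only [act, Smat, Fintype.sum_prod_type]
  rw [Finset.sum_eq_single x.1.1]
  · simp
  · intro i _ hi
    simp [hi.symm]
  · simp

theorem act_S2mat (F : SmithForm M) (d : ℕ) (f : Fin H × Fin s → E)
    (x : {x : PIdx s γ // d ≤ (x.1.1 : ℕ)}) :
    act (S2mat F γ d) (fun y : Fin (H - d) × Fin s =>
      f (⟨d + (y.1 : ℕ), by have := y.1.2; omega⟩, y.2)) x = act (Smat F γ) f x.1 := by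
  have hx := x.1.1.1.2
  have hx2 := x.2
  have h5 : d + ((x.1.1.1 : ℕ) - d) = (x.1.1.1 : ℕ) := by omega
  rw [act_Smat]
  simp only [act, S2mat, Matrix.submatrix_apply, Smat, Fintype.sum_prod_type]
  rw [Finset.sum_eq_single (⟨(x.1.1.1 : ℕ) - d, by omega⟩ : Fin (H - d))]
  · simp only [h5, if_true]
  · intro i _ hi
    refine Finset.sum_eq_zero fun c _ => ?_
    rw [if_neg, zero_smul]
    intro h
    have := congrArg Fin.val h
    exact hi (Fin.ext (by simp only at this ⊢; omega))
  · simp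

theorem act_Umat_transpose (f : Fin s × Fin H → E) (y : Fin H × Fin s) :
    act (Umat s H).transpose f y = f (y.2, y.1) := by
  simp only [act, Matrix.transpose_apply, Umat, ite_smul, one_smul, zero_smul]
  rw [Finset.sum_eq_single (y.2, y.1)]
  · simp
  · intro x _ hx
    rw [if_neg]
    rintro ⟨h1, h2⟩
    exact hx (Prod.ext h1 h2)
  · simp

theorem act_Rmat (f : Fin H × Fin s → E) (x : PIdx s γ) : act (Rmat s γ) f x = f x.1 := by
  simp only [act, Rmat, ite_smul, one_smul, zero_smul]
  simp

theorem act_Rmat_transpose (f : PIdx s γ → E) (y : Fin H × Fin s) :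
    act (Rmat s γ).transpose f y =
      if h : (y.2 : ℕ) < cum γ y.1 then f ⟨y, h⟩ else 0 := by
  simp only [act, Matrix.transpose_apply, Rmat, ite_smul, one_smul, zero_smul]
  split_ifs with h
  · rw [Finset.sum_eq_single ⟨y, h⟩]
    · simp
    · intro x _ hx
      rw [if_neg]
      intro h'
      exact hx (Subtype.ext h')
    · simp
  · refine Finset.sum_eq_zero fun x _ => if_neg ?_
    rintro rfl
    exact h x.2

theorem frakStack_apply (F : SmithForm M) (J : ℤ) (L : ℕ) (x : Fin s × Fin H)
    (y : Fin L × Fin s) :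
    frakStack F J H L x y =
      if ((y.1 : ℕ) : ℤ) ≤ (x.2 : ℕ) + (F.g x.1 : ℕ) - J then
        (F.P⁻¹ x.1 y.2).coeff (((x.2 : ℕ) : ℤ) + (F.g x.1 : ℕ) - J - (y.1 : ℕ)).toNat else 0 := by
  unfold frakStack SmithForm.frakCoeff
  simp only [Matrix.map_apply]
  split_ifs <;> first | rfl | omega | (congr 1; omega)

theorem le_excess (F : SmithForm M) (J : ℤ) (k : Fin s) : (F.g k : ℤ) - J ≤ F.excess J := by
  have : F.g k ≤ Finset.univ.sup F.g := Finset.le_sup (Finset.mem_univ k)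
  unfold SmithForm.excess
  omega

theorem excess_eq_zero (F : SmithForm M) (hs : 0 < s) {J : ℤ} (h : ∀ k, (F.g k : ℤ) ≤ J) :
    F.excess J = 0 := by
  have h0 := h ⟨0, hs⟩
  have : Finset.univ.sup F.g ≤ J.toNat := Finset.sup_le fun k _ => by have := h k; omega
  unfold SmithForm.excess
  omega

/-- `𝔓^{(L)}` applied to a stack evaluates `α(z)⁻¹ P(z)⁻¹ z^J` on the sequence that it comes from. -/
theorem act_frakStack (F : SmithForm M) (J : ℤ) (L : ℕ) (b : ℤ → Fin s → E)
    (hb : ∀ l < 0, b l = 0) (x : Fin s × Fin H)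
    (hL : ((x.2 : ℕ) : ℤ) + (F.g x.1 : ℕ) - J < L) :
    lagAct F.P⁻¹ b ((x.2 : ℕ) + (F.g x.1 : ℕ) - J) x.1 =
      act (frakStack F J H L) (fun y => b (y.1 : ℕ) y.2) x := by
  rw [lagAct_apply]
  simp only [act, frakStack_apply, Fintype.sum_prod_type]
  rw [Finset.sum_comm]
  refine Finset.sum_congr rfl fun c _ => ?_
  exact sum_smul_eq_truncated _ (fun τ => b τ c) (fun l hl => congrFun (hb l hl) c) _ L hL

theorem act_frakToeplitz (F : SmithForm M) (L : ℕ) (b : ℤ → Fin s → E)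
    (hb : ∀ l < 0, b l = 0) (x : Fin L × Fin s) :
    lagAct F.P⁻¹ b (x.1 : ℕ) x.2 = act (frakToeplitz F L) (fun y => b (y.1 : ℕ) y.2) x := by
  rw [lagAct_apply]
  simp only [act, Fintype.sum_prod_type]
  rw [Finset.sum_comm]
  refine Finset.sum_congr rfl fun c _ => ?_
  have := x.1.2
  rw [sum_smul_eq_truncated _ (fun τ => b τ c) (fun l hl => congrFun (hb l hl) c) _ L (by omega)]
  refine Finset.sum_congr rfl fun l _ => ?_
  unfold frakToeplitz SmithForm.frakCoeff
  simp only [Matrix.map_apply]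
  split_ifs <;> first | rfl | omega | (congr 2; omega)

theorem act_omega0 (F : SmithForm M) {b : ℤ → Fin s → E} {i : ℤ} (hb : ∀ l < i, b l = 0)
    (c : Fin s) : lagAct F.omega b i c = act F.omega0 (b i) c := by
  rw [lagAct_apply, act]
  refine Finset.sum_congr rfl fun c' _ => ?_
  rw [polyShift_apply, Polynomial.sum_over_range _ (by simp), Finset.sum_eq_single 0]
  · simp [SmithForm.omega0, SmithForm.omega]
  · intro n _ hn
    rw [hb _ (by omega), Pi.zero_apply, smul_zero]
  · simp

/-- If `S` annihilates the stack of `(ω(z) b)_i`, `0 ≤ i < H`, and the components of `b_i` are zero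
from the index `n_i` on, then `b_i = 0`: the blocks of `S` are left inverses of the first `n_i`
columns of `ω₀`, so that the system can be solved recursively. -/
theorem eq_zero_of_act_Smat (F : SmithForm M) {b : ℤ → Fin s → E} (hneg : ∀ l < 0, b l = 0)
    (hb : ∀ (i : Fin H) (c : Fin s), cum γ i ≤ (c : ℕ) → b (i : ℕ) c = 0)
    (hS : act (Smat F γ) (fun y : Fin H × Fin s => lagAct F.omega b (y.1 : ℕ) y.2) = 0)
    (i : Fin H) : b (i : ℕ) = 0 := by
  obtain ⟨i, hi⟩ := i
  induction i using Nat.strong_induction_on with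
  | _ i ih =>
    have hlt : ∀ l < (i : ℤ), b l = 0 := by
      intro l hl
      rcases lt_or_ge l 0 with h | h
      · exact hneg l h
      · lift l to ℕ using h
        exact ih l (by omega) (by omega)
    funext c
    rcases le_or_gt (cum γ i) (c : ℕ) with hc | hc
    · exact hb ⟨i, hi⟩ c hc
    · have h1 := congrFun hS ⟨(⟨i, hi⟩, c), hc⟩
      rw [act_Smat] at h1
      simp only [act_omega0 F hlt] at h1
      have h2 : act F.omega0 (b (i : ℤ)) =
          act (firstCols F.omega0 (cum γ i)) (fun c => b (i : ℤ) c.1) := by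
        funext r
        simp only [act, firstCols]
        rw [← Finset.sum_subtype (Finset.univ.filter fun c : Fin s => (c : ℕ) < cum γ i)
          (fun c => by simp) fun c => F.omega0 r c • b (i : ℤ) c, eq_comm]
        refine Finset.sum_subset (Finset.subset_univ _) fun c _ hc => ?_
        rw [hb ⟨i, hi⟩ c (by simpa using hc), smul_zero]
      have h3 : act (pinv (firstCols F.omega0 (cum γ i))) (act F.omega0 (b (i : ℤ))) ⟨c, hc⟩ = 0 := h1
      rw [h2, ← act_mul, pinv_mul_firstCols] at h3
      simpa [act, Matrix.one_apply] using h3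

end Stacks

/-! ### The structural difference equation -/

section Equation

variable {Ω : Type*} [MeasurableSpace Ω] {μ : Measure Ω} {s q K H : ℕ}
  {A : Fin (K + 1) → Fin (H + 1) → Matrix (Fin s) (Fin s) ℝ} {F : SmithForm (piPoly A)}
  {γ : Fin (H + 1) → ℕ}
  {u : ℤ → Fin s → Lp ℝ 2 μ} {eps : ℤ → Fin q → Lp ℝ 2 μ} {w : ℕ → Matrix (Fin s) (Fin q) ℝ}
  {e : Fin H → ℤ → Fin s → Lp ℝ 2 μ} {y : ℤ → Fin s → Lp ℝ 2 μ}

/-- `ε⁰_t + ε¹_{t-1} + ⋯ + ε^{H-1}_{t-H+1}`. -/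
def revisionSum (e : Fin H → ℤ → Fin s → Lp ℝ 2 μ) : ℤ → Fin s → Lp ℝ 2 μ :=
  fun t c => ∑ j : Fin H, e j (t - (j : ℕ)) c

/-- `ζ_t - u_t`. -/
def zetaSub (A : Fin (K + 1) → Fin (H + 1) → Matrix (Fin s) (Fin s) ℝ)
    (u : ℤ → Fin s → Lp ℝ 2 μ) (e : Fin H → ℤ → Fin s → Lp ℝ 2 μ) : ℤ → Fin s → Lp ℝ 2 μ :=
  fun t c => zeta A e t c - u t c

theorem lagAct_translate {m n : Type*} [Fintype n] (B : Matrix m n (Polynomial ℝ))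
    (x : ℤ → n → Lp ℝ 2 μ) (a t : ℤ) (r : m) :
    lagAct B (fun τ => x (τ + a)) t r = lagAct B x (t + a) r := by
  simp only [lagAct_apply]
  exact Finset.sum_congr rfl fun c _ => polyShift_translate _ (fun τ => x τ c) a t

theorem forcing_eq (t : ℤ) (k : Fin s) :
    forcing A F u e t k = lagAct F.P⁻¹ (zetaSub A u e) (t + (F.g k : ℕ) - J1 A) k :=
  lagAct_translate F.P⁻¹ (zetaSub A u e) (-J1 A) (t + (F.g k : ℕ)) k

/-- Multiplication by the invertible operator `α(z)⁻¹ P(z)⁻¹` turns the structural difference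
equation into `Φ(z) Q(z) (y_t - ε⁰_t - ⋯ - ε^{H-1}_{t-H+1}) = α(z)⁻¹ P(z)⁻¹ (ζ_{t-J₁} - u_{t-J₁})`. -/
theorem solvesSDE_iff (F : SmithForm (piPoly A)) :
    SolvesSDE A u e y ↔ lagAct F.omega (y - revisionSum e) = forcing A F u e := by
  set r : ℤ → Fin s → Lp ℝ 2 μ := fun τ c => zeta A e (τ - J1 A) c - u (τ - J1 A) c with hr
  have h1 : SolvesSDE A u e y ↔ lagAct (piPoly A) (y - revisionSum e) = r := by
    rw [lagAct_sub, sub_eq_iff_eq_add']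
    constructor
    · intro h
      funext t c
      rw [h t c, Pi.add_apply, Pi.add_apply, add_sub_assoc]
      rfl
    · intro h t c
      rw [h, Pi.add_apply, Pi.add_apply, add_sub_assoc]
      rfl
  have h2 : lagAct (piPoly A) (y - revisionSum e) = lagAct F.P (lagAct
      (Matrix.diagonal fun k => (Polynomial.X : Polynomial ℝ) ^ F.g k)
        (lagAct F.omega (y - revisionSum e))) := by
    rw [← lagAct_mul, ← lagAct_mul]
    congr 1
    rw [SmithForm.omega, ← Matrix.mul_assoc]
    exact F.eq
  have h3 : ∀ x : ℤ → Fin s → Lp ℝ 2 μ, lagAct F.P x = r ↔ x = lagAct F.P⁻¹ r := by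
    intro x
    constructor
    · rintro h
      rw [← h, ← lagAct_mul, F.inv_mul, lagAct_one]
    · rintro rfl
      rw [← lagAct_mul, F.mul_inv, lagAct_one]
  rw [h1, h2, h3]
  constructor
  · intro h
    funext t k
    have := congrFun (congrFun h (t + (F.g k : ℕ))) k
    rw [lagAct_diagonal, polyShift_X_pow, add_sub_cancel_right] at this
    exact this
  · intro h
    rw [h]
    funext t k
    rw [lagAct_diagonal, polyShift_X_pow]
    change lagAct F.P⁻¹ r (t - (F.g k : ℕ) + (F.g k : ℕ)) k = _
    rw [sub_add_cancel]

theorem IsPreMDS.isInnovation (he : IsPreMDS γ u e) (j : Fin H) (t : ℤ) (c : Fin s) :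
    IsInnovation u t (e j t c) :=
  ⟨(he j t c).1 ▸ proj_mem t _, proj_eq_zero_iff.1 (he j t c).2.1⟩

theorem IsPreMDS.innov_eq (he : IsPreMDS γ u e) (j : Fin H) (t τ : ℤ) (c : Fin s) :
    innov u τ (e j t c) = if τ = t then e j t c else 0 :=
  (he.isInnovation j t c).innov_eq

theorem IsPreMDS.revisionSum_mem (he : IsPreMDS γ u e) (t : ℤ) (c : Fin s) :
    revisionSum e t c ∈ info u t :=
  Submodule.sum_mem _ fun j _ => info_mono (by omega) (he.isInnovation j _ c).1

/-- The innovation of `ε⁰_t + ⋯ + ε^{H-1}_{t-H+1}` at time `t - i` is `ε^i_{t-i}`. -/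
theorem IsPreMDS.innov_revisionSum (he : IsPreMDS γ u e) (τ : ℤ) (i : Fin H) (c : Fin s) :
    innov u τ (revisionSum e (τ + (i : ℕ)) c) = e i τ c := by
  unfold revisionSum
  simp only [innov_sum, he.innov_eq]
  rw [Finset.sum_eq_single i]
  · rw [if_pos (by omega)]
    congr 1
    omega
  · intro j _ hj
    rw [if_neg]
    intro h
    exact hj (Fin.ext (by omega))
  · simp

theorem IsPreMDS.zeta_mem (he : IsPreMDS γ u e) (t : ℤ) (c : Fin s) : zeta A e t c ∈ info u t := by
  refine Submodule.neg_mem _ (Submodule.sum_mem _ fun k _ => Submodule.sum_mem _ fun j _ =>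
    Submodule.sum_mem _ fun h hh => Submodule.sum_mem _ fun c' _ => Submodule.smul_mem _ _ ?_)
  have := (Finset.mem_filter.1 hh).2
  exact info_mono (by omega) (he.isInnovation j _ c').1

theorem IsPreMDS.zetaSub_mem (he : IsPreMDS γ u e) (t : ℤ) (c : Fin s) :
    zetaSub A u e t c ∈ info u t :=
  Submodule.sub_mem _ (he.zeta_mem t c) (mem_info_self le_rfl c)

/-- The innovation of `ζ_{τ+l}` at time `τ` is `m_{l,•} ε^•_τ`. -/
theorem IsPreMDS.innov_zeta (he : IsPreMDS γ u e) (τ : ℤ) (l : ℕ) (r : Fin s) :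
    innov u τ (zeta A e (τ + l) r) = act (mCoeff A l) (fun y => e y.1 τ y.2) r := by
  have h1 : ∀ (k : Fin (K + 1)) (j : Fin H) (h : Fin (H + 1)), (h : ℕ) ≤ (j : ℕ) →
      innov u τ (act (A k h) (e j (τ + l - ((k : ℕ) + (j : ℕ) - (h : ℕ) : ℤ))) r) =
        if (k : ℕ) + (j : ℕ) = l + (h : ℕ) then act (A k h) (e j τ) r else 0 := by
    intro k j h _
    rw [innov_act]
    simp only [he.innov_eq]
    split_ifs with h1 h2 h2
    · rw [show τ + l - ((k : ℕ) + (j : ℕ) - (h : ℕ) : ℤ) = τ by omega]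
    · omega
    · omega
    · simp [act]
  unfold zeta
  rw [innov_neg]
  simp only [innov_sum]
  simp only [act, mCoeff, neg_smul, Finset.sum_neg_distrib, Fintype.sum_prod_type,
    Finset.sum_smul]
  congr 1
  have h2 : ∀ (k : Fin (K + 1)) (j : Fin H),
      ∑ h ∈ Finset.univ.filter (fun h : Fin (H + 1) => (h : ℕ) ≤ (j : ℕ)),
        innov u τ (act (A k h) (e j (τ + l - ((k : ℕ) + (j : ℕ) - (h : ℕ) : ℤ))) r) =
      ∑ c, ∑ h : Fin (H + 1), (if (h : ℕ) ≤ (j : ℕ) ∧ (k : ℕ) + (j : ℕ) = l + (h : ℕ)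
        then A k h r c else 0) • e j τ c := by
    intro k j
    rw [Finset.sum_filter, Finset.sum_comm]
    refine Finset.sum_congr rfl fun h _ => ?_
    by_cases hj : (h : ℕ) ≤ (j : ℕ)
    · rw [if_pos hj, h1 k j h hj]
      by_cases hk : (k : ℕ) + (j : ℕ) = l + (h : ℕ)
      · simp [hj, hk, act]
      · simp [hk]
    · simp [hj]
  have h3 := Finset.sum_congr (rfl : (Finset.univ : Finset (Fin (K + 1))) = _) fun k _ =>
    Finset.sum_congr (rfl : (Finset.univ : Finset (Fin H)) = _) fun j _ => h2 k j
  refine h3.trans ?_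
  rw [Finset.sum_comm]
  refine Finset.sum_congr rfl fun j _ => ?_
  rw [Finset.sum_comm]

/-- The sequence `l ↦ (𝔼_τ - 𝔼_{τ-1}) x_{τ+l}`. -/
def innovSeq (u : ℤ → Fin s → Lp ℝ 2 μ) (τ : ℤ) (x : ℤ → Fin s → Lp ℝ 2 μ) :
    ℤ → Fin s → Lp ℝ 2 μ := fun l c => innov u τ (x (τ + l) c)

theorem innovSeq_neg {x : ℤ → Fin s → Lp ℝ 2 μ} (hx : ∀ t c, x t c ∈ info u t) (τ : ℤ) :
    ∀ l < 0, innovSeq u τ x l = 0 := fun l hl => by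
  funext c
  exact innov_eq_zero (by omega) (hx (τ + l) c)

theorem innov_lagAct {m : Type*} (B : Matrix m (Fin s) (Polynomial ℝ)) (τ l : ℤ)
    (x : ℤ → Fin s → Lp ℝ 2 μ) (r : m) :
    innov u τ (lagAct B x (τ + l) r) = lagAct B (innovSeq u τ x) l r := by
  have h1 : lagAct B x (τ + l) r = lagAct B (fun σ => x (σ + τ)) l r := by
    rw [lagAct_translate, add_comm]
  rw [h1]
  simp only [lagAct_apply, innov_sum, innov_polyShift, innovSeq]
  simp only [add_comm τ]

/-- The innovation of the forcing process, in terms of the innovations of `ζ - u`. -/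
theorem innov_forcing (τ i : ℤ) (k : Fin s) :
    innov u τ (forcing A F u e (τ + i) k) =
      lagAct F.P⁻¹ (innovSeq u τ (zetaSub A u e)) (i + (F.g k : ℕ) - J1 A) k := by
  rw [forcing_eq, ← innov_lagAct]
  congr 2
  ring

/-- As `S` is block diagonal, the constraints can be shifted to the time of the innovation. -/
theorem constraints_iff :
    Constraints A F γ u e ↔ ∀ τ, act (Smat F γ) (fun y : Fin H × Fin s =>
      innov u τ (forcing A F u e (τ + (y.1 : ℕ)) y.2)) = 0 := by
  constructor
  · intro h τ
    funext x
    have := congrFun (h (τ + (x.1.1 : ℕ))) x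
    rw [act_Smat] at this ⊢
    rw [← this]
    simp only [add_sub_cancel_right]
  · intro h t
    funext x
    have := congrFun (h (t - (x.1.1 : ℕ))) x
    rw [act_Smat] at this ⊢
    rw [← this]
    simp only [sub_add_cancel]

theorem IsPreMDS.epsP_transpose (he : IsPreMDS γ u e) (t : ℤ) :
    act (Rmat s γ).transpose (epsP γ e t) = fun y => e y.1 t y.2 := by
  funext y
  rw [act_Rmat_transpose]
  split_ifs with h
  · rw [epsP, act_Rmat]
  · exact ((he y.1 t y.2).2.2 (by omega)).symm

/-- The stacked innovations of `ζ - u`. -/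
theorem IsPreMDS.stack_eq (he : IsPreMDS γ u e) (τ : ℤ) (L : ℕ) :
    (fun y : Fin L × Fin s => innovSeq u τ (zetaSub A u e) (y.1 : ℕ) y.2) =
      act (mStack A L * (Rmat s γ).transpose) (epsP γ e τ) - innovStack u L τ := by
  funext y
  rw [act_mul, he.epsP_transpose, Pi.sub_apply, innovSeq, zetaSub, innov_sub, he.innov_zeta]
  rfl

/-- The constraints as a linear system, with `L` large enough for all entries of `α⁻¹ P⁻¹`. -/
theorem IsPreMDS.constraints_iff_stack (he : IsPreMDS γ u e) {L : ℕ}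
    (hL : L = H + F.excess (J1 A)) :
    Constraints A F γ u e ↔ ∀ t, act (constraintMat A F γ L) (epsP γ e t) =
      act (SUP F (J1 A) γ L) (innovStack u L t) := by
  rw [constraints_iff]
  refine forall_congr' fun τ => ?_
  have h1 : (fun y : Fin H × Fin s => innov u τ (forcing A F u e (τ + (y.1 : ℕ)) y.2)) =
      act ((Umat s H).transpose * frakStack F (J1 A) H L)
        (fun y : Fin L × Fin s => innovSeq u τ (zetaSub A u e) (y.1 : ℕ) y.2) := by
    funext y
    rw [act_mul, act_Umat_transpose, innov_forcing]
    refine act_frakStack F (J1 A) L _ (innovSeq_neg he.zetaSub_mem τ) (y.2, y.1) ?_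
    have h2 := le_excess F (J1 A) y.2
    have h3 := y.1.2
    simp only
    omega
  rw [h1, he.stack_eq, ← act_mul, act_sub, sub_eq_zero, ← act_mul, ← Matrix.mul_assoc,
    ← Matrix.mul_assoc]
  rfl

/-- If all `g_k` are equal, only the last `H - d` blocks contribute. -/
theorem IsPreMDS.constraints_iff_toeplitz (he : IsPreMDS γ u e) {gbar d : ℕ}
    (hg : ∀ k, F.g k = gbar) (hd : (d : ℤ) = J1 A - gbar) :
    Constraints A F γ u e ↔ ∀ t,
      act (S2mat F γ d * frakToeplitz F (H - d) * mStack A (H - d) * (Rmat s γ).transpose)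
        (epsP γ e t) = act (S2mat F γ d * frakToeplitz F (H - d)) (innovStack u (H - d) t) := by
  rw [constraints_iff]
  refine forall_congr' fun τ => ?_
  rw [Matrix.mul_assoc (S2mat F γ d * frakToeplitz F (H - d)),
    act_mul (S2mat F γ d * frakToeplitz F (H - d)), ← sub_eq_zero (b := act (_ * _) _), ← act_sub,
    ← he.stack_eq, act_mul]
  have hneg := innovSeq_neg (he.zetaSub_mem (A := A)) τ
  have h1 : ∀ (i : Fin H) (k : Fin s), (i : ℕ) < d →
      innov u τ (forcing A F u e (τ + (i : ℕ)) k) = 0 := by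
    intro i k hi
    rw [innov_forcing, lagAct_apply]
    refine Finset.sum_eq_zero fun c _ => ?_
    rw [polyShift_apply]
    refine Finset.sum_eq_zero fun n _ => ?_
    have h2 := hg k
    simp only [hneg _ (show ((i : ℕ) : ℤ) + (F.g k : ℕ) - J1 A - n < 0 by omega), Pi.zero_apply,
      smul_zero]
  have h2 : ∀ y : Fin (H - d) × Fin s,
      innov u τ (forcing A F u e (τ + ((d + (y.1 : ℕ) : ℕ) : ℤ)) y.2) =
      act (frakToeplitz F (H - d))
        (fun y : Fin (H - d) × Fin s => innovSeq u τ (zetaSub A u e) (y.1 : ℕ) y.2) y := by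
    intro y
    rw [innov_forcing, ← act_frakToeplitz F (H - d) _ hneg, hg]
    congr 1
    push_cast
    omega
  have h3 : ∀ x : {x : PIdx s γ // d ≤ (x.1.1 : ℕ)},
      act (S2mat F γ d) (act (frakToeplitz F (H - d))
        (fun y : Fin (H - d) × Fin s => innovSeq u τ (zetaSub A u e) (y.1 : ℕ) y.2)) x =
      act (Smat F γ) (fun y : Fin H × Fin s =>
        innov u τ (forcing A F u e (τ + (y.1 : ℕ)) y.2)) x.1 := by
    intro x
    rw [← act_S2mat]
    congr 1
    funext y
    exact (h2 y).symm
  constructor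
  · intro h
    funext x
    rw [h3, h]
    rfl
  · intro h
    funext x
    rcases lt_or_ge (x.1.1 : ℕ) d with hx | hx
    · rw [act_Smat]
      simp only [h1 _ _ hx]
      simp [act]
    · rw [← h3 ⟨x, hx⟩, h]
      rfl

/-! ### The rational expectations model -/

/-- If the `ε^j` are the revisions of `y`, then replacing the predictions by
`𝔼_τ y_{τ+h} = y_{τ+h} - ∑_{j<h} ε^j_{τ+h-j}` turns the model into the difference equation. -/
theorem solvesRE_iff (hy : ∀ t c, y t c ∈ info u t)
    (he : ∀ (j : Fin H) t c, e j t c = innov u t (y (t + (j : ℕ)) c)) :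
    SolvesRE A u y ↔ SolvesSDE A u e y := by
  have h1 : ∀ (k : Fin (K + 1)) (h : Fin (H + 1)) (t : ℤ) (c : Fin s),
      proj u (t - (k : ℕ)) (y (t + (h : ℕ) - (k : ℕ)) c) = y (t + (h : ℕ) - (k : ℕ)) c -
        ∑ j : Fin H, if (j : ℕ) < (h : ℕ) then e j (t + (h : ℕ) - (k : ℕ) - (j : ℕ)) c else 0 := by
    intro k h t c
    have h2 := sum_range_innov (u := u) (t + (h : ℕ) - (k : ℕ)) (y (t + (h : ℕ) - (k : ℕ)) c) h
    rw [proj_eq_self (hy _ c)] at h2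
    have h3 : t + ((h : ℕ) : ℤ) - (k : ℕ) - (h : ℕ) = t - (k : ℕ) := by ring
    rw [h3] at h2
    have h4 : (∑ j : Fin H, if (j : ℕ) < (h : ℕ) then
        e j (t + (h : ℕ) - (k : ℕ) - (j : ℕ)) c else 0) =
        ∑ n ∈ Finset.range h, innov u (t + (h : ℕ) - (k : ℕ) - (n : ℕ))
          (y (t + (h : ℕ) - (k : ℕ)) c) := by
      simp only [he, sub_add_cancel]
      rw [Fin.sum_univ_eq_sum_range (fun j => if j < (h : ℕ) then
        innov u (t + (h : ℕ) - (k : ℕ) - (j : ℕ)) (y (t + (h : ℕ) - (k : ℕ)) c) else 0) H,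
        ← Finset.sum_filter]
      refine Finset.sum_congr ?_ fun _ _ => rfl
      ext n
      have := h.2
      simp only [Finset.mem_filter, Finset.mem_range]
      omega
    rw [h4, h2]
    abel
  have h2 : ∀ t r, lagAct (piPoly A) (revisionSum e) (t + J1 A) r + zeta A e t r =
      ∑ k : Fin (K + 1), ∑ h : Fin (H + 1), act (A k h) (fun c => ∑ j : Fin H,
        if (j : ℕ) < (h : ℕ) then e j (t + (h : ℕ) - (k : ℕ) - (j : ℕ)) c else 0) r := by
    intro t r
    have hz : zeta A e t r = -∑ k : Fin (K + 1), ∑ h : Fin (H + 1), act (A k h) (fun c =>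
        ∑ j : Fin H, if (j : ℕ) < (h : ℕ) then 0 else
          e j (t + (h : ℕ) - (k : ℕ) - (j : ℕ)) c) r := by
      unfold zeta
      congr 1
      refine Finset.sum_congr rfl fun k _ => ?_
      simp only [Finset.sum_filter]
      rw [Finset.sum_comm]
      refine Finset.sum_congr rfl fun h _ => ?_
      simp only [act, Finset.smul_sum]
      rw [Finset.sum_comm]
      refine Finset.sum_congr rfl fun j _ => ?_
      rcases lt_or_ge (j : ℕ) (h : ℕ) with hj | hj
      · rw [if_neg (by omega)]
        simp [hj]
      · rw [if_pos hj]
        simp only [if_neg (show ¬ (j : ℕ) < (h : ℕ) by omega)]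
        refine Finset.sum_congr rfl fun c _ => ?_
        rw [show t - (((k : ℕ) : ℤ) + (j : ℕ) - (h : ℕ)) = t + (h : ℕ) - (k : ℕ) - (j : ℕ) by ring]
    rw [lagAct_piPoly, hz, ← sub_eq_add_neg, ← Finset.sum_sub_distrib]
    refine Finset.sum_congr rfl fun k _ => ?_
    rw [← Finset.sum_sub_distrib]
    refine Finset.sum_congr rfl fun h _ => ?_
    rw [← Pi.sub_apply, ← act_sub]
    congr 1
    funext c
    simp only [Pi.sub_apply, revisionSum, ← Finset.sum_sub_distrib]
    refine Finset.sum_congr rfl fun j _ => ?_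
    split_ifs <;> simp
  have h3 : ∀ t r, (∑ k : Fin (K + 1), ∑ h : Fin (H + 1),
      act (A k h) (fun c => proj u (t - (k : ℕ)) (y (t + (h : ℕ) - (k : ℕ)) c)) r) =
      lagAct (piPoly A) y (t + J1 A) r -
        (lagAct (piPoly A) (revisionSum e) (t + J1 A) r + zeta A e t r) := by
    intro t r
    rw [h2, lagAct_piPoly, ← Finset.sum_sub_distrib]
    refine Finset.sum_congr rfl fun k _ => ?_
    rw [← Finset.sum_sub_distrib]
    refine Finset.sum_congr rfl fun h _ => ?_
    rw [← Pi.sub_apply, ← act_sub]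
    congr 1
    funext c
    exact h1 k h t c
  unfold SolvesRE SolvesSDE
  simp only [h3]
  constructor
  · intro h t r
    have := h (t - J1 A) r
    rw [sub_add_cancel, sub_eq_iff_eq_add] at this
    rw [this]
    change _ = lagAct (piPoly A) (revisionSum e) t r + _ - _
    abel
  · intro h t r
    have := h (t + J1 A) r
    rw [add_sub_cancel_right] at this
    rw [this]
    change lagAct (piPoly A) (revisionSum e) _ r + _ - _ - _ = _
    abel

/-- Innovations of both sides of the transformed difference equation. -/
theorem innov_forcing_of_solvesSDE (hsol : SolvesSDE A u e y) (τ i : ℤ) (k : Fin s) :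
    innov u τ (forcing A F u e (τ + i) k) =
      lagAct F.omega (innovSeq u τ (y - revisionSum e)) i k := by
  rw [← (solvesSDE_iff F).1 hsol, innov_lagAct]

theorem mdsOf_apply (X : Matrix (PIdx s γ) (Fin q) ℝ) (j : Fin H) (t : ℤ) (c : Fin s) :
    mdsOf γ eps X j t c =
      if h : (c : ℕ) < cum γ j then act X (eps t) ⟨(j, c), h⟩ else 0 := by
  rw [mdsOf, act_mul, act_Rmat_transpose]

theorem epsP_mdsOf (X : Matrix (PIdx s γ) (Fin q) ℝ) (t : ℤ) :
    epsP γ (mdsOf γ eps X) t = act X (eps t) := by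
  funext x
  rw [epsP, act_Rmat, mdsOf_apply, dif_pos x.2]

theorem IsWold.isPreMDS_mdsOf (hu : IsWold u eps w) (X : Matrix (PIdx s γ) (Fin q) ℝ) :
    IsPreMDS γ u (mdsOf γ eps X) := by
  intro j t c
  have hmem : ∀ V : Submodule ℝ (Lp ℝ 2 μ), (∀ b, eps t b ∈ V) → mdsOf γ eps X j t c ∈ V :=
    fun V hV => by
      unfold mdsOf act
      exact V.sum_mem fun b _ => V.smul_mem _ (hV b)
  have h : IsInnovation u t (mdsOf γ eps X j t c) :=
    ⟨hmem _ fun b => (hu.isInnovation t b).1, hmem _ fun b => (hu.isInnovation t b).2⟩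
  refine ⟨proj_eq_self h.1, proj_eq_zero_iff.2 h.2, fun hc => ?_⟩
  rw [mdsOf_apply, dif_neg (by omega)]

/-- Predetermined causal stationary processes: solutions of the model and of the equation. -/
theorem IsWold.solvesRE_iff_exists (hu : IsWold u eps w) (F : SmithForm (piPoly A))
    (hy : IsCausalStationary eps y) (hpre : IsPredetermined γ u y) :
    SolvesRE A u y ↔ ∃ X ∈ freeParams A F γ u eps, SolvesSDE A u (mdsOf γ eps X) y := by
  constructor
  · intro hre
    obtain ⟨κ, hκ⟩ := hy
    let X : Matrix (PIdx s γ) (Fin q) ℝ := fun x b => κ x.1.1 x.1.2 b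
    have hX : ∀ (j : Fin H) t c, mdsOf γ eps X j t c = innov u t (y (t + (j : ℕ)) c) := by
      intro j t c
      rw [mdsOf_apply]
      split_ifs with h
      · have := (hu.hasTransfer_of_filter hκ c (t + (j : ℕ))).2 j
        simp only [add_sub_cancel_right, PowerSeries.coeff_mk] at this
        rw [this]
        rfl
      · exact (hpre.2 j t c (by omega)).symm
    have hsol : SolvesSDE A u (mdsOf γ eps X) y := (solvesRE_iff hpre.1 hX).1 hre
    have hmds := hu.isPreMDS_mdsOf (γ := γ) X
    refine ⟨X, constraints_iff.2 fun τ => ?_, hsol⟩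
    -- the first `H` innovations of `y_t - ε⁰_t - ⋯` vanish
    have hb : ∀ l < (H : ℤ), innovSeq u τ (y - revisionSum (mdsOf γ eps X)) l = 0 := by
      intro l hl
      rcases lt_or_ge l 0 with h | h
      · exact innovSeq_neg (fun t c => Submodule.sub_mem _ (hpre.1 t c)
          (hmds.revisionSum_mem t c)) τ l h
      · lift l to ℕ using h
        funext c
        have := hmds.innov_revisionSum τ ⟨l, by omega⟩ c
        simp only at this
        rw [innovSeq, Pi.sub_apply, Pi.sub_apply, innov_sub, this, hX, sub_self]
        rfl
    have h0 : (fun y : Fin H × Fin s => innov u τ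
        (forcing A F u (mdsOf γ eps X) (τ + (y.1 : ℕ)) y.2)) = 0 := by
      funext z
      have hz := z.1.2
      rw [innov_forcing_of_solvesSDE hsol, act_omega0 F (fun l hl => hb l (by omega)),
        hb _ (by omega)]
      simp [act]
    rw [h0]
    funext x
    simp [act]
  · rintro ⟨X, hXF, hsol⟩
    have hmds := hu.isPreMDS_mdsOf (γ := γ) X
    refine (solvesRE_iff hpre.1 fun j t c => ?_).2 hsol
    have hsub : ∀ (i : Fin H) (c : Fin s),
        innovSeq u t (y - revisionSum (mdsOf γ eps X)) (i : ℕ) c =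
          innov u t (y (t + (i : ℕ)) c) - mdsOf γ eps X i t c := by
      intro i c
      rw [innovSeq, Pi.sub_apply, Pi.sub_apply, innov_sub, hmds.innov_revisionSum]
    have hz := eq_zero_of_act_Smat F (γ := γ)
      (b := innovSeq u t (y - revisionSum (mdsOf γ eps X)))
      (innovSeq_neg (fun t c => Submodule.sub_mem _ (hpre.1 t c) (hmds.revisionSum_mem t c)) t)
      (fun i c hc => by rw [hsub, hpre.2 i t c hc, (hmds i t c).2.2 hc, sub_zero])
      (by simpa only [innov_forcing_of_solvesSDE hsol] using constraints_iff.1 hXF t) j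
    have := congrFun hz c
    rw [hsub] at this
    exact (sub_eq_zero.1 this).symm

end Equation

/-! ### Dimension of the set of free parameters -/

section LinearAlgebra

theorem act_eq_mulVec {m n : Type*} [Fintype n] (B : Matrix m n ℝ) (x : n → ℝ) :
    act B x = B.mulVec x := rfl

/-- The solution set of `C X = D` is the translate of `q` copies of the kernel of `C`. -/
theorem isAffineOfDim_of_nonempty {m n : Type*} [Fintype m] [Fintype n] {q : ℕ} (C : Matrix m n ℝ)
    (D : Matrix m (Fin q) ℝ) (h : {X : Matrix n (Fin q) ℝ | C * X = D}.Nonempty) :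
    IsAffineOfDim {X : Matrix n (Fin q) ℝ | C * X = D} (kerDim C * q) := by
  obtain ⟨X₀, hX₀⟩ := h
  rw [Set.mem_ofPred_eq] at hX₀
  let T : Matrix n (Fin q) ℝ →ₗ[ℝ] Matrix m (Fin q) ℝ :=
    { toFun := fun X => C * X
      map_add' := Matrix.mul_add C
      map_smul' := fun a X => Matrix.mul_smul C a X }
  have hcol : ∀ (X : Matrix n (Fin q) ℝ), X ∈ LinearMap.ker T ↔
      ∀ b, (fun i => X i b) ∈ LinearMap.ker C.mulVecLin := by
    intro X
    simp only [LinearMap.mem_ker, Matrix.mulVecLin_apply]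
    constructor
    · intro hX b
      funext i
      exact congrFun (congrFun hX i) b
    · intro hX
      ext i b
      exact congrFun (hX b) i
  let Ψ : LinearMap.ker T ≃ₗ[ℝ] (Fin q → LinearMap.ker C.mulVecLin) :=
    { toFun := fun X b => ⟨fun i => X.1 i b, (hcol X.1).1 X.2 b⟩
      map_add' := fun _ _ => rfl
      map_smul' := fun _ _ => rfl
      invFun := fun f => ⟨fun i b => (f b).1 i, (hcol _).2 fun b => (f b).2⟩
      left_inv := fun _ => rfl
      right_inv := fun _ => rfl }
  refine ⟨AffineSubspace.mk' X₀ (LinearMap.ker T), ?_, ⟨X₀, hX₀⟩, ?_⟩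
  · ext X
    rw [SetLike.mem_coe, AffineSubspace.mem_mk', LinearMap.mem_ker, vsub_eq_sub, map_sub, sub_eq_zero]
    change C * X = C * X₀ ↔ C * X = D
    rw [hX₀]
  · rw [AffineSubspace.direction_mk', Ψ.finrank_eq, Module.finrank_pi_fintype]
    simp [kerDim, mul_comm]

theorem kerDim_add_card {m n : Type*} [Fintype m] [Fintype n] {C : Matrix m n ℝ}
    (hC : Function.Surjective C.mulVec) : kerDim C + Fintype.card m = Fintype.card n := by
  have h := LinearMap.finrank_range_add_finrank_ker C.mulVecLin
  rw [LinearMap.range_eq_top.2 hC, finrank_top] at h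
  simp only [Module.finrank_fintype_fun_eq_card] at h
  unfold kerDim
  omega

theorem nonempty_of_surjective {m n : Type*} [Fintype m] [Fintype n] {q : ℕ} {C : Matrix m n ℝ}
    (hC : Function.Surjective C.mulVec) (D : Matrix m (Fin q) ℝ) : {X : Matrix n (Fin q) ℝ | C * X = D}.Nonempty := by
  choose f hf using fun b : Fin q => hC fun i => D i b
  refine ⟨Matrix.of fun i b => f b i, ?_⟩
  rw [Set.mem_ofPred_eq]
  ext i b
  exact congrFun (hf b) i

theorem mulVec_surjective_of_rank {m n : Type*} [Fintype m] [Fintype n] {C : Matrix m n ℝ}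
    (hC : C.rank = Fintype.card m) : Function.Surjective C.mulVec := by
  have : LinearMap.range C.mulVecLin = ⊤ := by
    apply Submodule.eq_top_of_finrank_eq
    rw [← Matrix.rank, hC, Module.finrank_fintype_fun_eq_card]
  exact LinearMap.range_eq_top.1 this

variable {s K H : ℕ} {M : Matrix (Fin s) (Fin s) (Polynomial ℝ)} {γ : Fin (H + 1) → ℕ}

theorem Smat_surjective (F : SmithForm M) (γ : Fin (H + 1) → ℕ) :
    Function.Surjective (Smat F γ).mulVec := by
  intro g
  refine ⟨fun y => act (firstCols F.omega0 (cum γ y.1)) (fun c => g ⟨(y.1, c.1), c.2⟩) y.2, ?_⟩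
  funext x
  rw [← act_eq_mulVec, act_Smat]
  have h := act_mul (pinv (firstCols F.omega0 (cum γ x.1.1))) (firstCols F.omega0 (cum γ x.1.1))
    (fun c => g ⟨(x.1.1, c.1), c.2⟩)
  rw [pinv_mul_firstCols, act_eq_mulVec, Matrix.one_mulVec] at h
  exact (congrFun h ⟨x.1.2, x.2⟩).symm

theorem S2mat_surjective (F : SmithForm M) (γ : Fin (H + 1) → ℕ) (d : ℕ) :
    Function.Surjective (S2mat F γ d).mulVec := by
  intro g
  obtain ⟨f, hf⟩ := Smat_surjective F γ fun x => if h : d ≤ (x.1.1 : ℕ) then g ⟨x, h⟩ else 0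
  refine ⟨fun y => f (⟨d + (y.1 : ℕ), by have := y.1.2; omega⟩, y.2), ?_⟩
  funext x
  rw [← act_eq_mulVec, act_S2mat, act_eq_mulVec, hf]
  exact dif_pos x.2

/-- The Toeplitz matrix of `P⁻¹` is inverted by the Toeplitz matrix of `P`. -/
theorem frakToeplitz_surjective (F : SmithForm M) (L : ℕ) :
    Function.Surjective (frakToeplitz F L).mulVec := by
  intro f
  let f' : ℤ → Fin s → ℝ := fun l c =>
    if h : 0 ≤ l ∧ l < L then f (⟨l.toNat, by omega⟩, c) else 0
  have hneg : ∀ l < 0, lagAct F.P f' l = 0 := by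
    intro l hl
    funext c
    rw [lagAct_apply]
    refine Finset.sum_eq_zero fun c' _ => ?_
    rw [polyShift_apply]
    refine Finset.sum_eq_zero fun n _ => ?_
    simp only [f', dif_neg (show ¬ (0 ≤ l - n ∧ l - n < L) by omega), smul_zero]
  refine ⟨fun y => lagAct F.P f' (y.1 : ℕ) y.2, ?_⟩
  funext x
  have hx := x.1.2
  rw [← act_eq_mulVec, ← act_frakToeplitz F L _ hneg, ← lagAct_mul, F.inv_mul, lagAct_one]
  simp only [f']
  rw [dif_pos (by omega)]
  simp

end LinearAlgebra

section FreeParameters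

variable {Ω : Type*} [MeasurableSpace Ω] {μ : Measure Ω} {s q K H : ℕ}
  {A : Fin (K + 1) → Fin (H + 1) → Matrix (Fin s) (Fin s) ℝ} {F : SmithForm (piPoly A)}
  {γ : Fin (H + 1) → ℕ}
  {u : ℤ → Fin s → Lp ℝ 2 μ} {eps : ℤ → Fin q → Lp ℝ 2 μ} {w : ℕ → Matrix (Fin s) (Fin q) ℝ}

theorem IsWold.act_eps_injective (hu : IsWold u eps w) {m : Type*} {B C : Matrix m (Fin q) ℝ}
    {t : ℤ} (h : act B (eps t) = act C (eps t)) : B = C := by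
  ext r b
  have h1 : ∑ b, (B r b - C r b) • eps t b = 0 := by
    simp only [sub_smul, Finset.sum_sub_distrib]
    exact sub_eq_zero.2 (congrFun h r)
  exact sub_eq_zero.1 (Fintype.linearIndependent_iff.1 (hu.linearIndependent t) _ h1 b)

/-- The stack of `w₀, …, w_{L-1}`. -/
def wStack (w : ℕ → Matrix (Fin s) (Fin q) ℝ) (L : ℕ) : Matrix (Fin L × Fin s) (Fin q) ℝ :=
  fun y b => w y.1 y.2 b

theorem IsWold.innovStack_eq (hu : IsWold u eps w) (L : ℕ) (t : ℤ) :
    innovStack u L t = act (wStack w L) (eps t) := by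
  funext y
  have := (hu.hasTransfer_of_filter hu.eq y.2 (t + (y.1 : ℕ))).2 y.1
  simp only [add_sub_cancel_right, PowerSeries.coeff_mk] at this
  exact this

/-- Comparison of the coefficients of `ε_t` turns the constraints into a matrix equation. -/
theorem IsWold.freeParams_eq (hu : IsWold u eps w) {m : Type*} {L : ℕ}
    {C : Matrix m (PIdx s γ) ℝ} {B : Matrix m (Fin L × Fin s) ℝ}
    (h : ∀ e, IsPreMDS γ u e → (Constraints A F γ u e ↔
      ∀ t, act C (epsP γ e t) = act B (innovStack u L t))) :
    freeParams A F γ u eps =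
      {X : Matrix (PIdx s γ) (Fin q) ℝ | C * X = B * wStack w L} := by
  ext X
  rw [freeParams, Set.mem_ofPred_eq, Set.mem_ofPred_eq, h _ (hu.isPreMDS_mdsOf X)]
  simp only [epsP_mdsOf, hu.innovStack_eq, ← act_mul]
  exact ⟨fun h => hu.act_eps_injective (h 0), fun h t => by rw [h]⟩

/-- If `m^{(H-d)} Rᵀ` has full row rank, then so has the whole constraint matrix, and the number of free
parameters is `q` times the difference of the numbers of columns and rows. -/
theorem IsWold.isAffineOfDim_toeplitz (hu : IsWold u eps w) (hγ : ∑ i, γ i = s) {gbar d : ℕ}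
    (hg : ∀ k, F.g k = gbar) (hd : (d : ℤ) = J1 A - gbar) (hdH : d ≤ H)
    (hrank : (mStack A (H - d) * (Rmat s γ).transpose).rank = s * (H - d)) :
    IsAffineOfDim (freeParams A F γ u eps)
      ((∑ i ∈ Finset.univ.filter (fun i : Fin (H + 1) => (i : ℕ) < d), γ i * (d - (i : ℕ))) * q) := by
  rw [hu.freeParams_eq fun e he => he.constraints_iff_toeplitz hg hd]
  have hsurj : Function.Surjective
      (S2mat F γ d * frakToeplitz F (H - d) * mStack A (H - d) * (Rmat s γ).transpose).mulVec := by
    rw [Matrix.mul_assoc (S2mat F γ d * frakToeplitz F (H - d))]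
    intro g
    obtain ⟨g₁, rfl⟩ := S2mat_surjective F γ d g
    obtain ⟨g₂, rfl⟩ := frakToeplitz_surjective F (H - d) g₁
    obtain ⟨g₃, rfl⟩ := mulVec_surjective_of_rank
      (C := mStack A (H - d) * (Rmat s γ).transpose) (by rw [hrank]; simp [mul_comm]) g₂
    exact ⟨g₃, by simp only [Matrix.mulVec_mulVec, Matrix.mul_assoc]⟩
  have hdim := isAffineOfDim_of_nonempty _ _ (nonempty_of_surjective hsurj
    (S2mat F γ d * frakToeplitz F (H - d) * wStack w (H - d)))
  have h1 := kerDim_add_card hsurj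
  rw [card_PIdx_sub hγ hdH, add_comm] at h1
  rwa [Nat.add_left_cancel h1] at hdim

end FreeParameters

/-! ### Inversion of polynomials in the shift -/

section Inversion

/-- The coefficients of `∏ (z - r)⁻¹` are absolutely summable if all `r` lie outside the closed unit
disc, as each factor is a geometric series. -/
theorem exists_summable_inverse_prod (m : Multiset ℂ) (hm : ∀ r ∈ m, 1 < ‖r‖) :
    ∃ a : PowerSeries ℂ,
      (((m.map fun r => Polynomial.X - Polynomial.C r).prod : Polynomial ℂ) : PowerSeries ℂ) * a = 1 ∧
      Summable fun n => ‖PowerSeries.coeff n a‖ := by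
  induction m using Multiset.induction_on with
  | empty =>
    refine ⟨1, by simp, summable_of_ne_finset_zero (s := {0}) fun n hn => ?_⟩
    rw [PowerSeries.coeff_one, if_neg (by simpa using hn), norm_zero]
  | cons r m ih =>
    obtain ⟨a, ha, hsum⟩ := ih fun r hr => hm r (Multiset.mem_cons_of_mem hr)
    have hr : 1 < ‖r‖ := hm r (Multiset.mem_cons_self r m)
    have hr0 : r ≠ 0 := by
      rintro rfl
      rw [norm_zero] at hr
      linarith
    set v : PowerSeries ℂ := -PowerSeries.invUnitsSub (Units.mk0 r hr0)
    have hv : ((Polynomial.X - Polynomial.C r : Polynomial ℂ) : PowerSeries ℂ) * v = 1 := by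
      have := PowerSeries.invUnitsSub_mul_sub (Units.mk0 r hr0)
      rw [Units.val_mk0] at this
      rw [Polynomial.coe_sub, Polynomial.coe_X, Polynomial.coe_C, ← this]
      ring
    have hvsum : Summable fun n => ‖PowerSeries.coeff n v‖ := by
      have h1 : ∀ n, ‖PowerSeries.coeff n v‖ = ‖r‖⁻¹ * (‖r‖⁻¹) ^ n := by
        intro n
        rw [map_neg, norm_neg, PowerSeries.coeff_invUnitsSub, one_divp, ← pow_succ', inv_pow,
          Units.val_inv_eq_inv_val, norm_inv, Units.val_pow_eq_pow_val, norm_pow, Units.val_mk0]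
      have h2 : Summable fun n : ℕ => (‖r‖⁻¹) ^ n :=
        summable_geometric_of_lt_one (inv_nonneg.2 (norm_nonneg r)) (inv_lt_one_of_one_lt₀ hr)
      exact (h2.mul_left ‖r‖⁻¹).congr fun n => (h1 n).symm
    refine ⟨v * a, ?_, ?_⟩
    · rw [Multiset.map_cons, Multiset.prod_cons, Polynomial.coe_mul, mul_mul_mul_comm, hv, ha, one_mul]
    · simp only [PowerSeries.coeff_mul]
      exact summable_norm_sum_mul_antidiagonal_of_summable_norm
        (f := fun n => PowerSeries.coeff n v) (g := fun n => PowerSeries.coeff n a) hvsum hsum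

theorem exists_summable_inverse (p : Polynomial ℝ) (hp0 : p.eval 0 ≠ 0)
    (hp : ∀ z : ℂ, Polynomial.aeval z p = 0 → 1 < ‖z‖) :
    ∃ a : PowerSeries ℝ, (p : PowerSeries ℝ) * a = 1 ∧
      Summable fun n => ‖PowerSeries.coeff n a‖ := by
  have hpne : p ≠ 0 := by
    rintro rfl
    simp at hp0
  set P : Polynomial ℂ := p.map (algebraMap ℝ ℂ) with hP
  have hPne : P ≠ 0 := (Polynomial.map_ne_zero_iff (algebraMap ℝ ℂ).injective).2 hpne
  obtain ⟨b, hb, hbsum⟩ := exists_summable_inverse_prod P.roots fun r hr => by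
    apply hp
    rw [Polynomial.mem_roots hPne, Polynomial.IsRoot, hP, Polynomial.eval_map_algebraMap] at hr
    exact hr
  have hfac : Polynomial.C P.leadingCoeff * (P.roots.map fun r => Polynomial.X - Polynomial.C r).prod
      = P := Polynomial.C_leadingCoeff_mul_prod_multiset_X_sub_C
        (IsAlgClosed.card_roots_eq_natDegree)
  have hc : P.leadingCoeff ≠ 0 := Polynomial.leadingCoeff_ne_zero.2 hPne
  have hinv : (p : PowerSeries ℝ) * (p : PowerSeries ℝ)⁻¹ = 1 := by
    apply PowerSeries.mul_inv_cancel
    simpa [Polynomial.coeff_zero_eq_eval_zero] using hp0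
  refine ⟨(p : PowerSeries ℝ)⁻¹, hinv, ?_⟩
  have h1 := congrArg (PowerSeries.map (algebraMap ℝ ℂ)) hinv
  rw [map_mul, map_one, ← Polynomial.polynomial_map_coe, ← hP] at h1
  have h2 : (P : PowerSeries ℂ) * (PowerSeries.C P.leadingCoeff⁻¹ * b) = 1 := by
    rw [← hfac, Polynomial.coe_mul, Polynomial.coe_C, mul_mul_mul_comm, hb, mul_one, ← map_mul, hfac,
      mul_inv_cancel₀ hc, map_one]
  have h3 := (left_inv_eq_right_inv ((mul_comm _ _).trans h1) h2)
  have h4 : ∀ n, ‖PowerSeries.coeff n (p : PowerSeries ℝ)⁻¹‖ =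
      ‖P.leadingCoeff⁻¹‖ * ‖PowerSeries.coeff n b‖ := by
    intro n
    rw [← norm_mul, ← PowerSeries.coeff_C_mul, ← h3, PowerSeries.coeff_map]
    simp
  simp only [h4]
  exact hbsum.mul_left _

variable {Ω : Type*} [MeasurableSpace Ω] {μ : Measure Ω} {s q : ℕ}
  {u : ℤ → Fin s → Lp ℝ 2 μ} {eps : ℤ → Fin q → Lp ℝ 2 μ} {w : ℕ → Matrix (Fin s) (Fin q) ℝ}

/-- A polynomial in the shift without zeros in the closed unit disc is invertible on causal stationary
processes. -/
theorem IsWold.exists_polyShift_eq (hu : IsWold u eps w) {p : Polynomial ℝ} (hp0 : p.eval 0 ≠ 0)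
    (hp : ∀ z : ℂ, Polynomial.aeval z p = 0 → 1 < ‖z‖) {x : ℤ → Lp ℝ 2 μ}
    {k : Fin q → PowerSeries ℝ} (hx : HasTransfer u eps x k) :
    ∃ h l, HasTransfer u eps h l ∧ polyShift p h = x := by
  obtain ⟨a, ha, hsum⟩ := exists_summable_inverse p hp0 hp
  have hS : ∀ t : ℤ, Summable fun n : ℕ => PowerSeries.coeff n a • x (t - n) := by
    intro t
    refine Summable.of_norm ?_
    simp only [norm_smul, hu.norm_eq hx]
    exact hsum.mul_right _
  let h : ℤ → Lp ℝ 2 μ := fun t => ∑' n : ℕ, PowerSeries.coeff n a • x (t - n)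
  have hh : HasTransfer u eps h fun b => a * k b := by
    refine fun t => ⟨(isClosed_info t).mem_of_tendsto (hS t).hasSum
      (Filter.Eventually.of_forall fun S => ?_), fun n => ?_⟩
    · exact Submodule.sum_mem _ fun n _ => Submodule.smul_mem _ _ (info_mono (by omega) (hx _).1)
    · have h1 : innov u (t - n) (h t) =
          ∑' j : ℕ, PowerSeries.coeff j a • innov u (t - n) (x (t - j)) := by
        simp only [h, ← innovL_apply]
        rw [(innovL u (t - n)).map_tsum (hS t)]
        simp only [map_smul]
      rw [h1, tsum_eq_sum (s := Finset.range (n + 1))]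
      · simp only [PowerSeries.coeff_mul, Finset.Nat.sum_antidiagonal_eq_sum_range_succ_mk,
          Finset.sum_smul]
        rw [Finset.sum_comm]
        refine Finset.sum_congr rfl fun j hj => ?_
        rw [Finset.mem_range] at hj
        have h2 := (hx (t - j)).2 (n - j)
        rw [show t - (j : ℤ) - ((n - j : ℕ) : ℤ) = t - n by omega] at h2
        rw [h2, Finset.smul_sum]
        simp only [smul_smul]
      · intro j hj
        rw [Finset.mem_range] at hj
        rw [innov_eq_zero (by omega) (hx (t - j)).1, smul_zero]
  refine ⟨h, _, hh, hu.eq_of_hasTransfer (k := k) ?_ hx⟩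
  have := hh.polyShift p
  simpa only [← mul_assoc, ha, one_mul] using this

end Inversion

/-! ### Causal stationary solutions of the difference equation -/

section Solutions

variable {Ω : Type*} [MeasurableSpace Ω] {μ : Measure Ω} {s q K H : ℕ}
  {A : Fin (K + 1) → Fin (H + 1) → Matrix (Fin s) (Fin s) ℝ} {F : SmithForm (piPoly A)}
  {γ : Fin (H + 1) → ℕ}
  {u : ℤ → Fin s → Lp ℝ 2 μ} {eps : ℤ → Fin q → Lp ℝ 2 μ} {w : ℕ → Matrix (Fin s) (Fin q) ℝ}

theorem SmithForm.norm_zero_phi (F : SmithForm (piPoly A)) (hz : ZerosOutside (piPoly A)) (k : Fin s)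
    (z : ℂ) (h : Polynomial.aeval z (F.phi k) = 0) : 1 < ‖z‖ := by
  refine hz z ?_ ?_
  · rintro rfl
    apply F.phi_zero k
    have h2 : Polynomial.aeval (algebraMap ℝ ℂ 0) (F.phi k) = 0 := by simpa using h
    rw [Polynomial.aeval_algebraMap_apply] at h2
    simpa using h2
  · rw [F.eq, Matrix.det_mul, Matrix.det_mul, Matrix.det_diagonal (d := F.phi), map_mul, map_mul,
      map_prod, Finset.prod_eq_zero (Finset.mem_univ k) h]
    simp

/-- The equation `π(z) y = …` has at most one solution with `y_t ∈ H_u(t)`. -/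
theorem IsWold.solution_unique (hu : IsWold u eps w) (hdet : (piPoly A).det ≠ 0)
    {e : Fin H → ℤ → Fin s → Lp ℝ 2 μ} {y y' : ℤ → Fin s → Lp ℝ 2 μ}
    (hy : ∀ t c, y t c ∈ info u t) (hy' : ∀ t c, y' t c ∈ info u t)
    (h : SolvesSDE A u e y) (h' : SolvesSDE A u e y') : y = y' := by
  have h0 : lagAct (piPoly A) (y - y') = 0 := by
    rw [lagAct_sub]
    funext t r
    rw [Pi.sub_apply, Pi.sub_apply, h t r, h' t r, sub_self]
    rfl
  have h1 : lagAct ((piPoly A).adjugate * piPoly A) (y - y') = 0 := by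
    rw [lagAct_mul, h0, lagAct_zero]
  rw [Matrix.adjugate_mul, Matrix.smul_one_eq_diagonal] at h1
  have h2 : ∀ c, (fun t => (y - y') t c) = 0 := by
    intro c
    refine hu.eq_zero_of_polyShift hdet (fun t => Submodule.sub_mem _ (hy t c) (hy' t c)) ?_
    funext t
    rw [← lagAct_diagonal (fun _ => (piPoly A).det) (y - y') t c, h1]
    rfl
  funext t c
  exact sub_eq_zero.1 (congrFun (h2 c) t)

theorem IsWold.hasTransfer_mdsOf (hu : IsWold u eps w) (X : Matrix (PIdx s γ) (Fin q) ℝ) (j : Fin H)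
    (c : Fin s) : ∃ k, HasTransfer u eps (fun t => mdsOf γ eps X j t c) k :=
  HasTransfer.exists_sum Finset.univ fun b _ =>
    ⟨_, (hu.hasTransfer_eps b).smul (((Rmat s γ).transpose * X) (j, c) b)⟩

theorem IsWold.hasTransfer_revisionSum (hu : IsWold u eps w) (X : Matrix (PIdx s γ) (Fin q) ℝ)
    (c : Fin s) : ∃ k, HasTransfer u eps (fun t => revisionSum (mdsOf γ eps X) t c) k := by
  choose k hk using fun j : Fin H => hu.hasTransfer_mdsOf X j c
  exact HasTransfer.exists_sum Finset.univ fun j _ => ⟨_, (hk j).delay (j : ℕ)⟩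

theorem IsWold.hasTransfer_zeta (hu : IsWold u eps w) (X : Matrix (PIdx s γ) (Fin q) ℝ)
    (r : Fin s) : ∃ k, HasTransfer u eps (fun t => -zeta A (mdsOf γ eps X) t r) k := by
  choose k hk using fun (j : Fin H) (c : Fin s) => hu.hasTransfer_mdsOf (γ := γ) X j c
  unfold zeta
  simp only [neg_neg]
  refine HasTransfer.exists_sum Finset.univ fun i _ => HasTransfer.exists_sum Finset.univ fun j _ =>
    HasTransfer.exists_sum _ fun h hh => HasTransfer.exists_sum Finset.univ fun c _ => ?_
  have h1 := (Finset.mem_filter.1 hh).2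
  refine (((hk j c).delay ((i : ℕ) + (j : ℕ) - (h : ℕ))).smul (A i h r c)).exists_of_eq ?_
  funext t
  rw [Pi.smul_apply, show (((i : ℕ) + (j : ℕ) - (h : ℕ) : ℕ) : ℤ) =
    ((i : ℕ) : ℤ) + (j : ℕ) - (h : ℕ) by omega]

theorem IsWold.hasTransfer_zetaSub (hu : IsWold u eps w) (X : Matrix (PIdx s γ) (Fin q) ℝ)
    (r : Fin s) : ∃ k, HasTransfer u eps (fun t => zetaSub A u (mdsOf γ eps X) t r) k := by
  obtain ⟨k, hk⟩ := hu.hasTransfer_zeta (A := A) X r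
  refine ((hk.add (hu.hasTransfer_of_filter hu.eq r)).smul (-1)).exists_of_eq ?_
  funext t
  rw [Pi.smul_apply, Pi.add_apply, neg_one_smul, zetaSub]
  abel

/-- If `g_k ≤ J₁`, then the forcing process does not look ahead. -/
theorem IsPreMDS.forcing_mem {e : Fin H → ℤ → Fin s → Lp ℝ 2 μ} (he : IsPreMDS γ u e)
    (hg : ∀ k, ((F.g k : ℕ) : ℤ) ≤ J1 A) (t : ℤ) (k : Fin s) : forcing A F u e t k ∈ info u t := by
  have hgk := hg k
  rw [forcing_eq, lagAct_apply]
  refine Submodule.sum_mem _ fun c _ => info_mono (by omega) (polyShift_mem_info _ fun τ hτ => ?_)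
  exact info_mono hτ (he.zetaSub_mem τ c)

theorem IsWold.generates_unique_iff (hu : IsWold u eps w) (hdet : (piPoly A).det ≠ 0)
    (F : SmithForm (piPoly A)) (hz : ZerosOutside (piPoly A)) (X : Matrix (PIdx s γ) (Fin q) ℝ) :
    (∃! y, Generates A γ u eps X y) ↔
      ∀ t k, forcing A F u (mdsOf γ eps X) t k ∈ info u t := by
  have hmds := hu.isPreMDS_mdsOf (γ := γ) X
  constructor
  · rintro ⟨y, ⟨hy, hsol⟩, -⟩ t k
    rw [← (solvesSDE_iff F).1 hsol, lagAct_apply]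
    exact Submodule.sum_mem _ fun c _ => polyShift_mem_info _ fun τ hτ =>
      info_mono hτ (Submodule.sub_mem _ (hy.mem_info hu τ c) (hmds.revisionSum_mem τ c))
  · intro hf
    -- the forcing process is causal stationary, so that `Φ(z)` and `Q(z)` can be inverted on it
    have hf' : ∀ k, ∃ l, HasTransfer u eps (fun t => forcing A F u (mdsOf γ eps X) t k) l := by
      intro k
      obtain ⟨l, hl⟩ := HasTransfer.lagAct F.P⁻¹ (fun c => hu.hasTransfer_zetaSub (A := A) X c) k
      have := hl.translate ((F.g k : ℕ) - J1 A) fun t => by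
        have := hf t k
        rwa [forcing_eq, add_sub_assoc] at this
      simpa only [forcing_eq, add_sub_assoc] using this
    choose l hl using hf'
    choose h m hm hh using fun k => hu.exists_polyShift_eq (F.phi_zero k) (F.norm_zero_phi hz k) (hl k)
    set v : ℤ → Fin s → Lp ℝ 2 μ := lagAct F.Q⁻¹ fun t k => h k t with hv
    have hvt : ∀ c, ∃ k, HasTransfer u eps (fun t => v t c) k :=
      HasTransfer.lagAct F.Q⁻¹ (x := fun t k => h k t) fun c => ⟨m c, hm c⟩
    have hω : lagAct F.omega v = forcing A F u (mdsOf γ eps X) := by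
      rw [SmithForm.omega, hv, lagAct_mul, ← lagAct_mul F.Q, Matrix.mul_nonsing_inv _ F.Q_unimodular,
        lagAct_one]
      funext t k
      rw [lagAct_diagonal]
      exact congrFun (hh k) t
    choose kv hkv using hvt
    choose kr hkr using fun c => hu.hasTransfer_revisionSum (γ := γ) X c
    refine ⟨v + revisionSum (mdsOf γ eps X),
      ⟨hu.isCausalStationary fun c => (hkv c).add (hkr c), ?_⟩, ?_⟩
    · rw [solvesSDE_iff F, add_sub_cancel_right, hω]
    · rintro y ⟨hy, hsol⟩
      refine hu.solution_unique hdet (hy.mem_info hu)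
        (fun t c => (((hkv c).add (hkr c)) t).1) hsol ?_
      rw [solvesSDE_iff F, add_sub_cancel_right, hω]

/-- A process solves the difference equation for at most one free parameter: the difference of the two
revision processes satisfies the recursive system that the constraints make uniquely solvable. -/
theorem IsWold.freeParam_unique (hu : IsWold u eps w) {X X' : Matrix (PIdx s γ) (Fin q) ℝ}
    (hX : X ∈ freeParams A F γ u eps) (hX' : X' ∈ freeParams A F γ u eps)
    {y : ℤ → Fin s → Lp ℝ 2 μ} (h : SolvesSDE A u (mdsOf γ eps X) y)
    (h' : SolvesSDE A u (mdsOf γ eps X') y) : X = X' := by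
  have hm := hu.isPreMDS_mdsOf (γ := γ) X
  have hm' := hu.isPreMDS_mdsOf (γ := γ) X'
  set x := revisionSum (mdsOf γ eps X') - revisionSum (mdsOf γ eps X) with hx
  have hsub : ∀ (i : Fin H) (c : Fin s), innovSeq u 0 x (i : ℕ) c =
      mdsOf γ eps X' i 0 c - mdsOf γ eps X i 0 c := by
    intro i c
    rw [innovSeq, hx, Pi.sub_apply, Pi.sub_apply, innov_sub, hm.innov_revisionSum,
      hm'.innov_revisionSum]
  have hω : lagAct F.omega x = forcing A F u (mdsOf γ eps X) - forcing A F u (mdsOf γ eps X') := by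
    rw [← (solvesSDE_iff F).1 h, ← (solvesSDE_iff F).1 h', ← lagAct_sub, sub_sub_sub_cancel_left]
  have hS : act (Smat F γ) (fun z : Fin H × Fin s =>
      lagAct F.omega (innovSeq u 0 x) (z.1 : ℕ) z.2) = 0 := by
    simp only [← innov_lagAct, hω, Pi.sub_apply, innov_sub]
    have h1 := act_sub (Smat F γ)
      (fun z : Fin H × Fin s => innov u 0 (forcing A F u (mdsOf γ eps X) (0 + (z.1 : ℕ)) z.2))
      (fun z : Fin H × Fin s => innov u 0 (forcing A F u (mdsOf γ eps X') (0 + (z.1 : ℕ)) z.2))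
    rw [constraints_iff.1 hX 0, constraints_iff.1 hX' 0, sub_self] at h1
    exact h1
  have hz := eq_zero_of_act_Smat F (γ := γ) (b := innovSeq u 0 x)
    (innovSeq_neg (fun t c => Submodule.sub_mem _ (hm'.revisionSum_mem t c)
      (hm.revisionSum_mem t c)) 0)
    (fun i c hc => by rw [hsub, (hm' i 0 c).2.2 hc, (hm i 0 c).2.2 hc, sub_self]) hS
  refine hu.act_eps_injective (t := 0) ?_
  rw [← epsP_mdsOf, ← epsP_mdsOf]
  funext i
  rw [epsP, epsP, act_Rmat, act_Rmat]
  have := congrFun (hz i.1.1) i.1.2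
  rw [hsub] at this
  exact (sub_eq_zero.1 this).symm

end Solutions

end REM

end

theorem mainTheorem3 {Ω : Type*} [MeasurableSpace Ω] (μ : Measure Ω) [IsProbabilityMeasure μ]
    (s q K H : ℕ) (A : Fin (K + 1) → Fin (H + 1) → Matrix (Fin s) (Fin s) ℝ)
    (hK : ∃ h, A (Fin.last K) h ≠ 0) (hH : ∃ k, A k (Fin.last H) ≠ 0)
    (hdet : (REM.piPoly A).det ≠ 0) (F : REM.SmithForm (REM.piPoly A))
    (γ : Fin (H + 1) → ℕ) (hγ : ∑ i, γ i = s)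
    (u : ℤ → Fin s → Lp ℝ 2 μ) (eps : ℤ → Fin q → Lp ℝ 2 μ)
    (w : ℕ → Matrix (Fin s) (Fin q) ℝ) (hu : REM.IsWold u eps w) :
    -- the setting: predetermined solutions of the model and free parameters of the equation
    (∀ y, REM.IsCausalStationary eps y → REM.IsPredetermined γ u y →
      (REM.SolvesRE A u y ↔
        ∃ X ∈ REM.freeParams A F γ u eps, REM.SolvesSDE A u (REM.mdsOf γ eps X) y)) ∧
    Fintype.card (REM.PIdx s γ) = ∑ i : Fin (H + 1), γ i * (H - (i : ℕ)) ∧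
    -- (1) the general case
    ((∀ e, REM.IsPreMDS γ u e →
        (REM.Constraints A F γ u e ↔ ∀ t,
          REM.act (REM.constraintMat A F γ (H + F.excess (REM.J1 A))) (REM.epsP γ e t) =
          REM.act (REM.SUP F (REM.J1 A) γ (H + F.excess (REM.J1 A)))
            (REM.innovStack u (H + F.excess (REM.J1 A)) t))) ∧
      ((REM.freeParams A F γ u eps).Nonempty →
        REM.IsAffineOfDim (REM.freeParams A F γ u eps)
          (REM.kerDim (REM.constraintMat A F γ (H + F.excess (REM.J1 A))) * q))) ∧
    -- (2) the case `g_i ≤ J₁`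
    ((∀ k, ((F.g k : ℕ) : ℤ) ≤ REM.J1 A) →
      (∀ e, REM.IsPreMDS γ u e →
        (REM.Constraints A F γ u e ↔ ∀ t,
          REM.act (REM.constraintMat A F γ H) (REM.epsP γ e t) =
          REM.act (REM.SUP F (REM.J1 A) γ H) (REM.innovStack u H t))) ∧
      ((REM.freeParams A F γ u eps).Nonempty →
        REM.IsAffineOfDim (REM.freeParams A F γ u eps)
          (REM.kerDim (REM.constraintMat A F γ H) * q))) ∧
    -- (3) the case `g_i = ḡ ≤ J₁`, with `d = J₁ - ḡ`
    (∀ gbar d : ℕ, (∀ k, F.g k = gbar) → (d : ℤ) = REM.J1 A - gbar →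
      Fintype.card {x : REM.PIdx s γ // d ≤ (x.1.1 : ℕ)} =
        (H - d) * (∑ i ∈ Finset.univ.filter (fun i : Fin (H + 1) => (i : ℕ) < d), γ i)
          + ∑ i ∈ Finset.univ.filter (fun i : Fin (H + 1) => d ≤ (i : ℕ)), γ i * (H - (i : ℕ)) ∧
      (∀ e, REM.IsPreMDS γ u e →
        (REM.Constraints A F γ u e ↔ ∀ t,
          REM.act (REM.S2mat F γ d * REM.frakToeplitz F (H - d) * REM.mStack A (H - d) *
            (REM.Rmat s γ).transpose) (REM.epsP γ e t) =
          REM.act (REM.S2mat F γ d * REM.frakToeplitz F (H - d))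
            (REM.innovStack u (H - d) t))) ∧
      ((REM.mStack A (H - d) * (REM.Rmat s γ).transpose).rank = s * (H - d) →
        ∃ N : ℕ, REM.IsAffineOfDim (REM.freeParams A F γ u eps) N ∧
          (N : ℤ) = (∑ i ∈ Finset.univ.filter (fun i : Fin (H + 1) => ((i : ℕ) : ℤ) < REM.J1 A),
            (γ i : ℤ) * (REM.J1 A - gbar - (i : ℕ))) * q)) ∧
    -- (4) the case `g_i = 0 ≤ J₁`, with `d = J₁`
    (∀ d : ℕ, (∀ k, F.g k = 0) → (d : ℤ) = REM.J1 A →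
      (∀ e, REM.IsPreMDS γ u e →
        (REM.Constraints A F γ u e ↔ ∀ t,
          REM.act (REM.S2mat F γ d * REM.frakToeplitz F (H - d) * REM.mStack A (H - d) *
            (REM.Rmat s γ).transpose) (REM.epsP γ e t) =
          REM.act (REM.S2mat F γ d * REM.frakToeplitz F (H - d))
            (REM.innovStack u (H - d) t))) ∧
      ((REM.mStack A (H - d) * (REM.Rmat s γ).transpose).rank = s * (H - d) →
        REM.IsAffineOfDim (REM.freeParams A F γ u eps)
          ((∑ i ∈ Finset.univ.filter (fun i : Fin (H + 1) => (i : ℕ) < d), γ i * (d - (i : ℕ))) * q))) ∧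
    -- (5) distinct free parameters give distinct causal stationary solutions
    (REM.ZerosOutside (REM.piPoly A) →
      (∀ X ∈ REM.freeParams A F γ u eps, ∀ X' ∈ REM.freeParams A F γ u eps, X ≠ X' →
        ∀ y y', REM.Generates A γ u eps X y → REM.Generates A γ u eps X' y' → y ≠ y') ∧
      (∀ X ∈ REM.freeParams A F γ u eps,
        (∃! y, REM.Generates A γ u eps X y) ↔
          ∀ t k, REM.forcing A F u (REM.mdsOf γ eps X) t k ∈ REM.info u t) ∧
      ((∀ k, ((F.g k : ℕ) : ℤ) ≤ REM.J1 A) →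
        ∀ X ∈ REM.freeParams A F γ u eps, ∃! y, REM.Generates A γ u eps X y)) := by
  -- a non-zero matrix `A_{kh}` exists only if `s > 0`
  have hs : 0 < s := by
    obtain ⟨h, hh⟩ := hK
    rcases Nat.eq_zero_or_pos s with rfl | hs
    · exact absurd (Subsingleton.elim _ _) hh
    · exact hs
  have hJ := REM.J1_le hs hdet
  have hdim : ∀ L, L = H + F.excess (REM.J1 A) →
      (REM.freeParams A F γ u eps).Nonempty → REM.IsAffineOfDim (REM.freeParams A F γ u eps)
        (REM.kerDim (REM.constraintMat A F γ L) * q) := by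
    intro L hL hne
    rw [hu.freeParams_eq fun e he => he.constraints_iff_stack hL] at hne ⊢
    exact REM.isAffineOfDim_of_nonempty _ _ hne
  refine ⟨fun y hy hpre => hu.solvesRE_iff_exists F hy hpre, REM.card_PIdx hγ,
    ⟨fun e he => he.constraints_iff_stack rfl, hdim _ rfl⟩, fun hg => ?_, fun gbar d hg hd => ?_,
    fun d hg hd => ?_, fun hz => ⟨?_, ?_, ?_⟩⟩
  · have h0 : H = H + F.excess (REM.J1 A) := by rw [REM.excess_eq_zero F hs hg, add_zero]
    exact ⟨fun e he => he.constraints_iff_stack h0, hdim _ h0⟩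
  · refine ⟨REM.card_PIdx_ge_split hγ d, fun e he => he.constraints_iff_toeplitz hg hd,
      fun hrank => ⟨_, hu.isAffineOfDim_toeplitz hγ hg hd (by omega) hrank, ?_⟩⟩
    have h0 := F.gbar_eq_zero hs hdet hg
    subst h0
    rw [Nat.cast_zero, sub_zero] at hd
    rw [← hd]
    push_cast
    simp only [Nat.cast_lt]
    congr 1
    refine Finset.sum_congr rfl fun i hi => ?_
    rw [Nat.cast_sub (Finset.mem_filter.1 hi).2.le, sub_zero]
  · have hd' : (d : ℤ) = REM.J1 A - (0 : ℕ) := by simpa using hd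
    exact ⟨fun e he => he.constraints_iff_toeplitz hg hd',
      hu.isAffineOfDim_toeplitz hγ hg hd' (by omega)⟩
  · rintro X hX X' hX' hne y y' hy hy' rfl
    exact hne (hu.freeParam_unique hX hX' hy.2 hy'.2)
  · exact fun X _ => hu.generates_unique_iff hdet F hz X
  · exact fun hg X _ => (hu.generates_unique_iff hdet F hz X).2
      ((hu.isPreMDS_mdsOf X).forcing_mem hg)
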